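/- Let $a>0$, $N\ge 0$, and let $Q$ be a smooth Hermitian $N\times N$ matrix valued function on the circle of radius $a$, i.e. a smooth $2\pi a$-periodic function of $x\in\mathbb R$. For $\varepsilon\in\mathbb R$ let $L_\varepsilon=-\partial_x^2+\varepsilon Q$ act on smooth $2\pi a$-periodic functions $\mathbb R\to\mathbb C^N$. For $t>0$ let $\Theta_\varepsilon(t)=\operatorname{Tr}e^{-tL_\varepsilon}=\sum_n e^{-t\lambda_n(\varepsilon)}$, the sum over the eigenvalues of $L_\varepsilon$ counted with multiplicity, and let $\Omega_\varepsilon(t)=(4\pi t)^{1/2}\,\Theta_\varepsilon(t)$. Put $$q_k=\frac1{2\pi a}\int_0^{2\pi a}e^{-ikx/a}Q(x)\,dx,\qquad |q_k|^2=\operatorname{tr}(q_kq_k^*)\qquad(k\in\mathbb Z),$$ and, for $s>0$, $k\in\mathbb Z$, $z\in\mathbb R$, $$\theta(s)=\sum_{n\in\mathbb Z}e^{-\pi^2n^2/s},\qquad \beta_k(s)=\int_0^1\sum_{n\in\mathbb Z}\exp\Big(-s\tfrac{1-\xi^2}{4}k^2-\tfrac{\pi^2n^2}{s}-ikn(1+\xi)\pi\Big)d\xi,\qquad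 \alpha(z)=\int_0^1e^{-(1-\xi^2)z/4}\,d\xi .$$ (1) For all $a$, $N$, $Q$ as above, the eigenspaces of every $L_\varepsilon$ are finite-dimensional, and for every $t>0$ the sum defining $\Theta_\varepsilon(t)$ converges for every $\varepsilon$, the series $\sum_k|q_k|^2\beta_k(t/a^2)$ converges absolutely, and, as $\varepsilon\to0$ with $a,Q,t$ fixed, $$\Omega_\varepsilon(t)=\theta\Big(\frac t{a^2}\Big)\,2\pi a\,\big(N-t\,\varepsilon\operatorname{tr}q_0\big)+\pi a t^2\sum_{k\in\mathbb Z}\varepsilon^2|q_k|^2\,\beta_k\Big(\frac t{a^2}\Big)+O(\varepsilon^3).$$ (2) For $s>0$ and $k\in\mathbb Z$ the series in $\theta(s)$ and in the integrand of $\beta_k(s)$ and those below converge, the two integrands of $\beta_k(s)$ are integrable on $[0,1]$, and $$\theta(s)=\frac{s^{1/2}}{\sqrt\pi}\sum_{n\in\mathbb Z}e^{-sn^2},\qquad \beta_k(s)=\frac{s^{1/2}}{\sqrt\pi}\int_0^1\sum_{n\in\mathbb Z}\exp\Big(-s\Big[n^2+\tfrac{1+\xi}{2}(k^2-2nk)\Big]\Big)d\xi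 .$$ (3) For every fixed $t>0$, as $a\to\infty$, $\beta_k(t/a^2)\sim\alpha(tk^2/a^2)$ for each $k\in\mathbb Z$, and the quotient $\beta_k(t/a^2)/\alpha(tk^2/a^2)$ tends to $1$ uniformly in $k\in\mathbb Z$. -/

import Mathlib

open Complex Filter Topology Asymptotics
open scoped ContDiff Matrix Interval

noncomputable section

namespace CircleHeat

/-- The Laplace type operator `-D² + Q` acting on `ℂᴺ`-valued functions of the coordinate `x`. -/
def laplaceOp {N : ℕ} (Q : ℝ → Matrix (Fin N) (Fin N) ℂ) (f : ℝ → Fin N → ℂ) :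
    ℝ → Fin N → ℂ :=
  fun x => -deriv (deriv f) x + Q x *ᵥ f x

/-- The space `C^∞(𝒱)` of smooth sections of the rank `N` bundle over the circle of radius `a`:
smooth `2πa`-periodic functions with values in `ℂᴺ`. -/
def smoothSections (a : ℝ) (N : ℕ) : Submodule ℂ (ℝ → Fin N → ℂ) where
  carrier := {f | ContDiff ℝ ∞ f ∧ Function.Periodic f (2 * Real.pi * a)}
  zero_mem' := ⟨contDiff_const, fun _ => rfl⟩
  add_mem' := by
    rintro f g ⟨hf, hf'⟩ ⟨hg, hg'⟩
    exact ⟨hf.add hg, hf'.add hg'⟩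
  smul_mem' := by
    rintro c f ⟨hf, hf'⟩
    exact ⟨contDiff_const.smul hf, hf'.smul c⟩

/-- The eigenspace of `-D² + Q` on smooth sections over the circle of radius `a`, for the
eigenvalue `lam`. -/
def eigenspace {N : ℕ} (a : ℝ) (Q : ℝ → Matrix (Fin N) (Fin N) ℂ) (lam : ℝ) :
    Submodule ℂ (ℝ → Fin N → ℂ) where
  carrier := {f | f ∈ smoothSections a N ∧ laplaceOp Q f = (lam : ℂ) • f}
  zero_mem' := by
    refine ⟨Submodule.zero_mem _, ?_⟩
    have h : deriv (0 : ℝ → Fin N → ℂ) = 0 := by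
      funext x
      simp
    funext x
    simp [laplaceOp, h]
  add_mem' := by
    rintro f g ⟨hf, hf'⟩ ⟨hg, hg'⟩
    refine ⟨Submodule.add_mem _ hf hg, ?_⟩
    have h1 : deriv (f + g) = deriv f + deriv g := by
      funext x
      exact deriv_add (hf.1.differentiable (by simp) x) (hg.1.differentiable (by simp) x)
    have h2 : deriv (deriv f + deriv g) = deriv (deriv f) + deriv (deriv g) := by
      have hf2 : ContDiff ℝ ∞ (deriv f) := (contDiff_infty_iff_deriv.1 hf.1).2
      have hg2 : ContDiff ℝ ∞ (deriv g) := (contDiff_infty_iff_deriv.1 hg.1).2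
      funext x
      exact deriv_add (hf2.differentiable (by simp) x) (hg2.differentiable (by simp) x)
    rw [smul_add, ← hf', ← hg']
    funext x
    simp only [laplaceOp, h1, h2, Pi.add_apply, Matrix.mulVec_add]
    abel
  smul_mem' := by
    rintro c f ⟨hf, hf'⟩
    refine ⟨Submodule.smul_mem _ c hf, ?_⟩
    have h1 : ∀ g : ℝ → Fin N → ℂ, deriv (c • g) = c • deriv g := by
      intro g
      funext x
      exact deriv_const_smul_field c g
    rw [smul_comm, ← hf']
    funext x
    simp only [laplaceOp, h1, Pi.smul_apply, Matrix.mulVec_smul, smul_add, smul_neg]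

/-- The heat trace `Θ(t) = Tr exp(-tL) = ∑ exp(-t λₙ)`, `L = -D² + Q`, summed over the eigenvalues
of `L` counted with multiplicity. -/
def heatTrace {N : ℕ} (a : ℝ) (Q : ℝ → Matrix (Fin N) (Fin N) ℂ) (t : ℝ) : ℝ :=
  ∑' lam : ℝ, (Module.finrank ℂ (eigenspace a Q lam) : ℝ) * Real.exp (-t * lam)

/-- The heat trace function `Ω(t)`, normalised by `Θ(t) = (4πt)^{-1/2} Ω(t)`. -/
def Omega {N : ℕ} (a : ℝ) (Q : ℝ → Matrix (Fin N) (Fin N) ℂ) (t : ℝ) : ℝ :=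
  Real.sqrt (4 * Real.pi * t) * heatTrace a Q t

/-- The matrix Fourier coefficient `qₖ = (2πa)⁻¹ ∫₀^{2πa} e^{-ikx/a} Q(x) dx`. -/
def fourierCoef {N : ℕ} (a : ℝ) (Q : ℝ → Matrix (Fin N) (Fin N) ℂ) (k : ℤ) :
    Matrix (Fin N) (Fin N) ℂ :=
  Matrix.of fun i j =>
    (1 / (2 * Real.pi * a) : ℂ) *
      ∫ x in (0 : ℝ)..(2 * Real.pi * a), cexp (-(I * k * x / a)) * Q x i j

/-- `|qₖ|² = tr (qₖ qₖ*)`. -/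
def coefNormSq {N : ℕ} (a : ℝ) (Q : ℝ → Matrix (Fin N) (Fin N) ℂ) (k : ℤ) : ℂ :=
  (fourierCoef a Q k * (fourierCoef a Q k)ᴴ).trace

/-- `θ(s) = ∑ₙ exp(-π² n² / s)`. -/
def theta (s : ℝ) : ℝ :=
  ∑' n : ℤ, Real.exp (-(1 / s * Real.pi ^ 2 * (n : ℝ) ^ 2))

/-- The `n`-th summand `exp(-s (1-ξ²)/4 k² - π² n² / s - i k n (1+ξ) π)` under the integral
defining `βₖ(s)`. -/
def betaTerm (k : ℤ) (s ξ : ℝ) (n : ℤ) : ℂ :=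
  cexp (-(s * ((1 - ξ ^ 2) / 4) * k ^ 2) - 1 / s * Real.pi ^ 2 * n ^ 2
    - I * k * n * (1 + ξ) * Real.pi)

/-- `βₖ(s) = ∫₀¹ ∑ₙ exp(-s (1-ξ²)/4 k² - π² n² / s - i k n (1+ξ) π) dξ`. -/
def beta (k : ℤ) (s : ℝ) : ℂ :=
  ∫ ξ in (0 : ℝ)..1, ∑' n : ℤ, betaTerm k s ξ n

/-- The `n`-th summand of the dual form of `βₖ(s)`. -/
def betaDualTerm (k : ℤ) (s ξ : ℝ) (n : ℤ) : ℝ :=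
  Real.exp (-(s * ((n : ℝ) ^ 2 + (1 + ξ) / 2 * ((k : ℝ) ^ 2 - 2 * n * k))))

/-- `α(z) = ∫₀¹ exp(-(1-ξ²) z / 4) dξ`. -/
def alpha (z : ℝ) : ℝ :=
  ∫ ξ in (0 : ℝ)..1, Real.exp (-((1 - ξ ^ 2) / 4 * z))

end CircleHeat

end

/-! In the Fourier basis `b` of modes and components, -∂² is the diagonal operator D with entries
m²/a², and multiplication by Q is convolution with the matrices q_k. Since the q_k are absolutely
summable, this is a bounded operator T, symmetric because Q is Hermitian. Smooth eigenfunctions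
correspond to ℓ² eigenvectors of D + εT (`nonempty_eigenspace_equiv`). The resolvent is compact and
symmetric, so there is an orthonormal eigenbasis (`exists_eigenbasis`). For fixed t, absorb t into
the operators: tD has entries μ_m, W = tεT, and (λ_n, φ_n) are the eigenpairs of tD + W.

The expansion rests on ⟨φ_n, W b_m⟩ = (λ_n - μ_m)⟨φ_n, b_m⟩. Write the trace as ∑_m ∑_n e^{-λ_n}
|⟨φ_n, b_m⟩|² and expand e^{-λ_n} about μ_m with the exact second-order remainder (λ_n - μ_m)²
`expRem λ_n μ_m`. The identity turns the linear term into ⟨b_m, W b_m⟩ and the remainder into ∑_n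
`expRem λ_n μ_m` |⟨φ_n, W b_m⟩|² (`heat_diagonal_eq`). Replacing the spectral data of tD + W by
those of tD in this last sum costs one more factor of W (`abs_tsum_expRem_sub_le`), and the decay
1/(1 + μ_m) makes the total error O(ε³).

The surviving second-order term involves |q_k|² ∑_m `expRem` (s(m+k)²) (sm²) with s = t/a². The
reflection m ↦ -k - m identifies the sum over m with half the integral in the dual form of β_k
(`hasSum_expRem`), and Poisson summation gives the original form (`tsum_betaTerm`). For large a the
n = 0 term of β_k is α, and every other term is relatively small with a bound free of k. -/

namespace CircleHeat

/-! ### Diagonal operators in a Hilbert basis. -/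

section HilbertSpace

variable {ι κ E : Type*} [NormedAddCommGroup E] [InnerProductSpace ℂ E]

theorem hasSum_norm_inner_sq (b : HilbertBasis ι ℂ E) (x : E) :
    HasSum (fun i => ‖inner ℂ (b i) x‖ ^ 2) (‖x‖ ^ 2) := by
  have h := b.hasSum_inner_mul_inner x x
  rw [inner_self_eq_norm_sq_to_K] at h
  have h2 := Complex.hasSum_re h
  convert h2 using 1
  · funext i
    rw [← inner_conj_symm x (b i), ← Complex.normSq_eq_conj_mul_self, Complex.ofReal_re,
      Complex.normSq_eq_norm_sq]
  · norm_cast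

theorem exists_inner_eq (b : HilbertBasis ι ℂ E) (f : ι → ℂ)
    (hf : Summable fun i => ‖f i‖ ^ 2) : ∃ x : E, ∀ i, inner ℂ (b i) x = f i := by
  have hm : Memℓp f 2 := by
    refine memℓp_gen ?_
    simpa using hf
  refine ⟨b.repr.symm ⟨f, hm⟩, fun i => ?_⟩
  rw [← b.repr_apply_apply, LinearIsometryEquiv.apply_symm_apply]

theorem ext_inner (b : HilbertBasis ι ℂ E) {x y : E}
    (h : ∀ i, inner ℂ (b i) x = inner ℂ (b i) y) : x = y := by
  apply b.repr.injective
  ext i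
  simp only [b.repr_apply_apply, h i]

theorem norm_le_of_norm_inner_le (b : HilbertBasis ι ℂ E) {x y : E} {C : ℝ} (hC : 0 ≤ C)
    (h : ∀ i, ‖inner ℂ (b i) x‖ ≤ C * ‖inner ℂ (b i) y‖) : ‖x‖ ≤ C * ‖y‖ := by
  refine le_of_sq_le_sq ?_ (by positivity)
  rw [mul_pow]
  refine hasSum_le (fun i => ?_) (hasSum_norm_inner_sq b x)
    ((hasSum_norm_inner_sq b y).mul_left (C ^ 2))
  rw [← mul_pow]
  exact pow_le_pow_left₀ (norm_nonneg _) (h i) 2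

/-- A bounded real function of the index acts as a diagonal operator in a Hilbert basis. -/
theorem exists_diagonal (b : HilbertBasis ι ℂ E) (d : ι → ℝ) {C : ℝ} (hC : 0 ≤ C)
    (hd : ∀ i, |d i| ≤ C) :
    ∃ D : E →L[ℂ] E, (∀ x i, inner ℂ (b i) (D x) = d i * inner ℂ (b i) x) ∧ ‖D‖ ≤ C := by
  have hex : ∀ x : E, ∃ y : E, ∀ i, inner ℂ (b i) y = d i * inner ℂ (b i) x := by
    intro x
    refine exists_inner_eq b _ ?_
    refine Summable.of_nonneg_of_le (fun i => by positivity) (fun i => ?_)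
      ((hasSum_norm_inner_sq b x).summable.mul_left (C ^ 2))
    rw [norm_mul, mul_pow]
    gcongr
    simpa using hd i
  choose F hF using hex
  have hn : ∀ x, ‖F x‖ ≤ C * ‖x‖ := by
    intro x
    refine norm_le_of_norm_inner_le b hC (fun i => ?_)
    rw [hF, norm_mul]
    gcongr
    simpa using hd i
  refine ⟨LinearMap.mkContinuous
    { toFun := F
      map_add' := fun x y => ext_inner b fun i => by
        simp only [hF, inner_add_right, mul_add]
      map_smul' := fun c x => ext_inner b fun i => by
        simp only [hF, inner_smul_right, RingHom.id_apply]
        ring } C hn, fun x i => hF x i, LinearMap.mkContinuous_norm_le _ hC _⟩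

theorem diagonal_symm (b : HilbertBasis ι ℂ E) {d : ι → ℝ} {D : E →L[ℂ] E}
    (hD : ∀ x i, inner ℂ (b i) (D x) = d i * inner ℂ (b i) x) (x y : E) :
    inner ℂ (D x) y = inner ℂ x (D y) := by
  rw [← (b.hasSum_inner_mul_inner (D x) y).tsum_eq, ← (b.hasSum_inner_mul_inner x (D y)).tsum_eq]
  refine tsum_congr fun i => ?_
  rw [← inner_conj_symm, hD, hD, map_mul, Complex.conj_ofReal, inner_conj_symm]
  ring

theorem diagonal_apply_basis [DecidableEq ι] (b : HilbertBasis ι ℂ E) {d : ι → ℝ} {D : E →L[ℂ] E}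
    (hD : ∀ x i, inner ℂ (b i) (D x) = d i * inner ℂ (b i) x) (j : ι) :
    D (b j) = (d j : ℂ) • b j := by
  refine ext_inner b fun i => ?_
  rw [hD, inner_smul_right, orthonormal_iff_ite.1 b.orthonormal]
  split_ifs with h <;> simp [h]

theorem hasSum_inner_diagonal (b : HilbertBasis ι ℂ E) {d : ι → ℝ} {D : E →L[ℂ] E}
    (hD : ∀ x i, inner ℂ (b i) (D x) = d i * inner ℂ (b i) x) (x : E) :
    HasSum (fun i => d i * ‖inner ℂ (b i) x‖ ^ 2) (inner ℂ x (D x)).re := by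
  have h := Complex.hasSum_re (b.hasSum_inner_mul_inner x (D x))
  convert h using 1
  funext i
  rw [hD, ← inner_conj_symm x (b i), mul_left_comm, ← Complex.normSq_eq_conj_mul_self,
    Complex.normSq_eq_norm_sq]
  norm_cast

/-- The truncations `P s` have finite rank and converge to `D` in norm, because `d` is uniformly
small off a finite set. -/
theorem isCompactOperator_diagonal [CompleteSpace E] (b : HilbertBasis ι ℂ E) {d : ι → ℝ} {D : E →L[ℂ] E}
    (hD : ∀ x i, inner ℂ (b i) (D x) = d i * inner ℂ (b i) x)
    (hd : Tendsto d cofinite (𝓝 0)) : IsCompactOperator D := by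
  classical
  let P : Finset ι → E →L[ℂ] E := fun s =>
    ∑ i ∈ s, (d i : ℂ) • (innerSL ℂ (b i)).smulRight (b i)
  have hP : ∀ s x i, inner ℂ (b i) (P s x) = (if i ∈ s then (d i : ℂ) else 0) * inner ℂ (b i) x := by
    intro s x i
    simp only [P, sum_apply, smul_apply,
      ContinuousLinearMap.smulRight_apply, inner_sum, inner_smul_right, innerSL_apply_apply,
      orthonormal_iff_ite.1 b.orthonormal]
    simp [Finset.sum_ite_eq]
  have hPc : ∀ s, IsCompactOperator (P s) := by
    intro s
    refine Submodule.sum_mem (compactOperator (RingHom.id ℂ) E E) fun i _ => ?_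
    refine Submodule.smul_mem _ _ ?_
    have h1 : ∀ f : E →L[ℂ] ℂ, IsCompactOperator f := fun f =>
      (isCompactOperator_id.comp_clm f :)
    exact (h1 (innerSL ℂ (b i))).clm_comp (ContinuousLinearMap.toSpanSingleton ℂ (b i))
  refine isCompactOperator_of_tendsto (l := atTop) (F := P) ?_ (Eventually.of_forall hPc)
  rw [tendsto_iff_norm_sub_tendsto_zero, Metric.tendsto_atTop]
  intro ε hε
  have hfin : ∀ᶠ i in cofinite, |d i| < ε / 2 := by
    have := (Metric.tendsto_nhds.1 hd) (ε / 2) (by positivity)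
    simpa using this
  refine ⟨(Filter.eventually_cofinite.1 hfin).toFinset, fun s hs => ?_⟩
  have : ‖P s - D‖ ≤ ε / 2 := by
    refine ContinuousLinearMap.opNorm_le_bound _ (by positivity) fun x => ?_
    refine norm_le_of_norm_inner_le b (by positivity) fun i => ?_
    rw [sub_apply, inner_sub_right, hP, hD, ← sub_mul, norm_mul]
    gcongr
    split_ifs with hi
    · simp; positivity
    · have : i ∉ (Filter.eventually_cofinite.1 hfin).toFinset := fun h => hi (hs h)
      simp at this
      simpa using this.le
  simp only [dist_zero_right, norm_norm]
  linarith

end HilbertSpace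

end CircleHeat

namespace CircleHeat

/-! ### Spectral theory of D + W through its compact resolvent. -/

section Eigenbasis

variable {ι E : Type*} [NormedAddCommGroup E] [InnerProductSpace ℂ E]

/-- The eigenspace of `D + W`, where `D` is diagonal with entries `μ` in the Hilbert basis `b`. -/
def pertEigenspace (b : HilbertBasis ι ℂ E) (μ : ι → ℝ) (W : E →L[ℂ] E) (lam : ℝ) :
    Submodule ℂ E where
  -- Stating the equation coefficientwise avoids naming a domain: it forces μ_i ⟨b_i, u⟩ to be the
  -- coefficients of the vector `lam u - W u`, so u lies in the domain of D.
  carrier := {u | ∀ i, (μ i : ℂ) * inner ℂ (b i) u + inner ℂ (b i) (W u) = lam * inner ℂ (b i) u}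
  zero_mem' := by simp
  add_mem' := by
    intro u v hu hv i
    simp only [map_add, inner_add_right]
    linear_combination hu i + hv i
  smul_mem' := by
    intro c u hu i
    simp only [map_smul, inner_smul_right]
    linear_combination c * hu i

variable {b : HilbertBasis ι ℂ E} {μ : ι → ℝ} {W : E →L[ℂ] E}

theorem mem_pertEigenspace {lam : ℝ} {u : E} : u ∈ pertEigenspace b μ W lam ↔
    ∀ i, (μ i : ℂ) * inner ℂ (b i) u + inner ℂ (b i) (W u) = lam * inner ℂ (b i) u := Iff.rfl

/-- The resolvent at `-c` of `D + W`, as a compact symmetric operator. -/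
theorem exists_resolvent [CompleteSpace E] (hμ0 : ∀ i, 0 ≤ μ i) (hμ : Tendsto μ cofinite atTop)
    (hW : ∀ x y, inner ℂ (W x) y = inner ℂ x (W y)) {c : ℝ} (hc : ‖W‖ < c) :
    ∃ R : E →L[ℂ] E, IsCompactOperator R ∧ R.IsSymmetric ∧ (∀ u, R u = 0 → u = 0) ∧
      ∀ (u : E) (lam : ℝ), u ∈ pertEigenspace b μ W lam ↔ u = ((lam + c : ℝ) : ℂ) • R u := by
  have hc0 : 0 < c := (norm_nonneg W).trans_lt hc
  have hpos : ∀ i, 0 < μ i + c := fun i => by linarith [hμ0 i]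
  -- `G` is (D + c)⁻¹, of norm at most 1/c. As ‖W‖ < c, the operator 1 + GW is invertible, and the
  -- resolvent is (1 + GW)⁻¹ G.
  obtain ⟨G, hG, hGn⟩ := exists_diagonal b (fun i => (μ i + c)⁻¹) (C := c⁻¹) (by positivity)
    (fun i => by
      rw [abs_of_pos (inv_pos.2 (hpos i))]
      exact inv_anti₀ hc0 (by linarith [hμ0 i]))
  have hGc : IsCompactOperator G := isCompactOperator_diagonal b hG
    (tendsto_inv_atTop_zero.comp (tendsto_atTop_add_const_right _ c hμ))
  have hsymm := diagonal_symm b hG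
  have hGW : ‖-(G * W)‖ < 1 := by
    rw [norm_neg]
    calc ‖G * W‖ ≤ ‖G‖ * ‖W‖ := norm_mul_le _ _
      _ ≤ c⁻¹ * ‖W‖ := by gcongr
      _ < c⁻¹ * c := by gcongr
      _ = 1 := inv_mul_cancel₀ hc0.ne'
  obtain ⟨A, hA⟩ := isUnit_one_sub_of_norm_lt_one hGW
  rw [sub_neg_eq_add] at hA
  set X : E →L[ℂ] E := ((A⁻¹ : (E →L[ℂ] E)ˣ) : E →L[ℂ] E) with hX
  have hXA : ∀ x, X (x + G (W x)) = x := by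
    intro x
    have : X * A = 1 := A.inv_mul
    rw [hA] at this
    simpa using DFunLike.congr_fun this x
  have hAX : ∀ x, X x + G (W (X x)) = x := by
    intro x
    have : A * X = 1 := A.mul_inv
    rw [hA] at this
    simpa using DFunLike.congr_fun this x
  refine ⟨X * G, hGc.clm_comp X, ?_, ?_, ?_⟩
  · intro x y
    -- Writing x = a + W G a gives R x = G a, and then ⟨G a, a' + W G a'⟩ is visibly symmetric
    -- because G and W are.
    have key : ∀ x, ∃ a, X (G x) = G a ∧ x = a + W (G a) := by
      intro x
      have h := hAX (G x)
      have h1 : X (G x) = G (x - W (X (G x))) := by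
        rw [map_sub]
        exact eq_sub_of_add_eq h
      exact ⟨x - W (X (G x)), h1, by rw [← h1]; abel⟩
    obtain ⟨a, ha, hx⟩ := key x
    obtain ⟨a', ha', hy⟩ := key y
    change inner ℂ (X (G x)) y = inner ℂ x (X (G y))
    rw [ha, ha']
    conv_lhs => rw [hy]
    conv_rhs => rw [hx]
    rw [inner_add_right, inner_add_left, hsymm, hW]
  · intro u hu
    have h := hAX (G u)
    have hu' : X (G u) = 0 := hu
    rw [hu', map_zero, map_zero, add_zero] at h
    refine ext_inner b fun i => ?_
    have := hG u i
    rw [← h, inner_zero_right] at this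
    rw [inner_zero_right]
    exact (mul_eq_zero.1 this.symm).resolve_left
      (by exact_mod_cast (inv_pos.2 (hpos i)).ne')
  · intro u lam
    have h1 : u = ((lam + c : ℝ) : ℂ) • (X * G) u ↔ u + G (W u) = ((lam + c : ℝ) : ℂ) • G u := by
      constructor
      · intro h
        have h2 : u = X (((lam + c : ℝ) : ℂ) • G u) := by rw [map_smul]; exact h
        have h3 := hAX (((lam + c : ℝ) : ℂ) • G u)
        rwa [← h2] at h3
      · intro h
        have := hXA u
        rw [h, map_smul] at this
        exact this.symm
    rw [h1]
    have h2 : ∀ i, (((μ i + c)⁻¹ : ℝ) : ℂ) * ((μ i : ℂ) + c) = 1 := by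
      intro i
      have := inv_mul_cancel₀ (hpos i).ne'
      exact_mod_cast this
    constructor
    · intro hu
      refine ext_inner b fun i => ?_
      rw [inner_add_right, inner_smul_right, hG, hG]
      push_cast [-Complex.ofReal_inv] at h2 ⊢
      linear_combination (((μ i + c)⁻¹ : ℝ) : ℂ) * (mem_pertEigenspace.1 hu i) -
        inner ℂ (b i) u * h2 i
    · intro hu i
      have h := congrArg (inner ℂ (b i)) hu
      rw [inner_add_right, inner_smul_right, hG, hG] at h
      push_cast [-Complex.ofReal_inv] at h2 h
      linear_combination ((μ i : ℂ) + c) * h -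
        (inner ℂ (b i) (W u) - ((lam : ℂ) + c) * inner ℂ (b i) u) * h2 i

theorem finiteDimensional_pertEigenspace [CompleteSpace E] (hμ0 : ∀ i, 0 ≤ μ i) (hμ : Tendsto μ cofinite atTop)
    (hW : ∀ x y, inner ℂ (W x) y = inner ℂ x (W y)) (lam : ℝ) :
    FiniteDimensional ℂ (pertEigenspace b μ W lam) := by
  -- This c makes `lam + c` positive, so the eigenvectors for `lam` belong to a nonzero eigenvalue
  -- of the compact operator R, whose eigenspace is finite-dimensional.
  obtain ⟨R, hRc, -, -, hR⟩ := exists_resolvent (b := b) hμ0 hμ hW (c := ‖W‖ + |lam| + 1)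
    (by linarith [abs_nonneg lam])
  have hpos : 0 < lam + (‖W‖ + |lam| + 1) := by linarith [neg_abs_le lam, norm_nonneg W]
  set d := lam + (‖W‖ + |lam| + 1)
  have hd : (d : ℂ) ≠ 0 := by exact_mod_cast hpos.ne'
  have : FiniteDimensional ℂ (Module.End.eigenspace R.toLinearMap ((d : ℂ)⁻¹)) :=
    ContinuousLinearMap.finite_dimensional_eigenspace hRc _ (inv_ne_zero hd)
  refine Submodule.finiteDimensional_of_le (S₂ := Module.End.eigenspace R.toLinearMap ((d : ℂ)⁻¹))
    fun u hu => ?_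
  rw [Module.End.mem_eigenspace_iff]
  have h := (hR u lam).1 hu
  change R u = _
  conv_rhs => rw [h]
  rw [smul_smul, inv_mul_cancel₀ hd, one_smul]

/-- D u = `lam u - W u` is a genuine vector, so the symmetry of D can be checked coefficient by
coefficient; the usual orthogonality argument then applies. -/
theorem inner_eq_zero_of_mem_pertEigenspace
    (hW : ∀ x y, inner ℂ (W x) y = inner ℂ x (W y)) {lam lam' : ℝ} (hne : lam ≠ lam') {u v : E}
    (hu : u ∈ pertEigenspace b μ W lam) (hv : v ∈ pertEigenspace b μ W lam') :
    inner ℂ u v = 0 := by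
  have h : inner ℂ ((lam : ℂ) • u - W u) v = inner ℂ u ((lam' : ℂ) • v - W v) := by
    rw [← (b.hasSum_inner_mul_inner _ _).tsum_eq, ← (b.hasSum_inner_mul_inner _ _).tsum_eq]
    refine tsum_congr fun i => ?_
    have h1 : inner ℂ (b i) ((lam : ℂ) • u - W u) = μ i * inner ℂ (b i) u := by
      rw [inner_sub_right, inner_smul_right]
      linear_combination -(mem_pertEigenspace.1 hu i)
    have h2 : inner ℂ (b i) ((lam' : ℂ) • v - W v) = μ i * inner ℂ (b i) v := by
      rw [inner_sub_right, inner_smul_right]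
      linear_combination -(mem_pertEigenspace.1 hv i)
    rw [h2, ← inner_conj_symm, h1, map_mul, Complex.conj_ofReal, inner_conj_symm]
    ring
  rw [inner_sub_left, inner_sub_right, inner_smul_left, inner_smul_right, hW,
    Complex.conj_ofReal] at h
  have h' : ((lam : ℂ) - lam') * inner ℂ u v = 0 := by linear_combination h
  refine (mul_eq_zero.1 h').resolve_left ?_
  exact sub_ne_zero.2 (by exact_mod_cast hne)

/-- The spectral theorem for R gives total eigenspaces. Each eigenvalue τ of R is nonzero by
injectivity and real by symmetry, and it comes from the eigenvalue τ⁻¹ - c of D + W. -/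
theorem orthogonal_iSup_pertEigenspace [CompleteSpace E] (hμ0 : ∀ i, 0 ≤ μ i) (hμ : Tendsto μ cofinite atTop)
    (hW : ∀ x y, inner ℂ (W x) y = inner ℂ x (W y)) :
    (⨆ lam, pertEigenspace b μ W lam)ᗮ = ⊥ := by
  obtain ⟨R, hRc, hRs, hR0, hR⟩ := exists_resolvent (b := b) hμ0 hμ hW (c := ‖W‖ + 1)
    (by linarith)
  rw [eq_bot_iff, ← ContinuousLinearMap.orthogonalComplement_iSup_eigenspaces_eq_bot hRc hRs]
  refine Submodule.orthogonal_le (iSup_le fun τ u hu => ?_)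
  rw [Module.End.mem_eigenspace_iff] at hu
  change R u = τ • u at hu
  by_cases hu0 : u = 0
  · rw [hu0]
    exact Submodule.zero_mem _
  have hτ : τ ≠ 0 := by
    rintro rfl
    exact hu0 (hR0 u (by rw [hu, zero_smul]))
  have hreal : starRingEnd ℂ τ = τ := by
    have h := hRs u u
    change inner ℂ (R u) u = inner ℂ u (R u) at h
    rw [hu, inner_smul_left, inner_smul_right] at h
    exact mul_right_cancel₀ (inner_self_ne_zero.2 hu0) h
  obtain ⟨r, rfl⟩ := Complex.conj_eq_iff_real.1 hreal
  refine Submodule.mem_iSup_of_mem (r⁻¹ - (‖W‖ + 1)) ?_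
  rw [hR, hu, smul_smul, sub_add_cancel, Complex.ofReal_inv, inv_mul_cancel₀ hτ, one_smul]

/-- An orthonormal basis of eigenvectors of `D + W`, each eigenvalue being repeated according to
its multiplicity. -/
theorem exists_eigenbasis [CompleteSpace E] (hμ0 : ∀ i, 0 ≤ μ i) (hμ : Tendsto μ cofinite atTop)
    (hW : ∀ x y, inner ℂ (W x) y = inner ℂ x (W y)) :
    ∃ φ : HilbertBasis (Σ lam : ℝ, Fin (Module.finrank ℂ (pertEigenspace b μ W lam))) ℂ E,
      ∀ n, φ n ∈ pertEigenspace b μ W n.1 := by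
  have hfd := finiteDimensional_pertEigenspace (b := b) hμ0 hμ hW
  let w : ∀ lam : ℝ, OrthonormalBasis (Fin (Module.finrank ℂ (pertEigenspace b μ W lam))) ℂ
    (pertEigenspace b μ W lam) := fun lam => stdOrthonormalBasis ℂ _
  let v : (Σ lam : ℝ, Fin (Module.finrank ℂ (pertEigenspace b μ W lam))) → E :=
    fun n => (w n.1 n.2 : E)
  have horth : OrthogonalFamily ℂ (fun lam => pertEigenspace b μ W lam)
      fun lam => (pertEigenspace b μ W lam).subtypeₗᵢ := by
    refine OrthogonalFamily.of_pairwise fun lam lam' hne => ?_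
    exact Submodule.isOrtho_iff_inner_eq.2 fun u hu v hv => inner_eq_zero_of_mem_pertEigenspace hW hne hu hv
  have hv : Orthonormal ℂ v :=
    horth.orthonormal_sigma_orthonormal (fun lam => (w lam).orthonormal)
  have hsp : (Submodule.span ℂ (Set.range v))ᗮ = ⊥ := by
    rw [eq_bot_iff, ← orthogonal_iSup_pertEigenspace (b := b) hμ0 hμ hW]
    refine Submodule.orthogonal_le (iSup_le fun lam u hu => ?_)
    have h := (w lam).sum_repr ⟨u, hu⟩
    have h2 := congrArg (pertEigenspace b μ W lam).subtype h
    simp only [map_sum, map_smul, Submodule.subtype_apply] at h2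
    rw [← h2]
    exact Submodule.sum_mem _ fun j _ => Submodule.smul_mem _ _
      (Submodule.subset_span ⟨⟨lam, j⟩, rfl⟩)
  refine ⟨HilbertBasis.mkOfOrthogonalEqBot hv hsp, fun n => ?_⟩
  rw [HilbertBasis.coe_mkOfOrthogonalEqBot]
  exact (w n.1 n.2).2

end Eigenbasis

end CircleHeat

namespace CircleHeat

/-! ### Exact second-order Taylor remainder of the exponential. -/

section ExponentialRemainder

/-- The second divided difference of `exp (-·)` at `x, y, y`, in integral form. -/
noncomputable def expRem (x y : ℝ) : ℝ := ∫ u in (0 : ℝ)..1, (1 - u) * Real.exp (-(u * x + (1 - u) * y))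

theorem intervalIntegrable_expRem (x y : ℝ) : IntervalIntegrable
    (fun u => (1 - u) * Real.exp (-(u * x + (1 - u) * y))) MeasureTheory.volume 0 1 :=
  Continuous.intervalIntegrable (by fun_prop) _ _

theorem exp_neg_eq_add_expRem (x y : ℝ) :
    Real.exp (-x) = Real.exp (-y) - (x - y) * Real.exp (-y) + (x - y) ^ 2 * expRem x y := by
  have h : ∫ u in (0 : ℝ)..1, (x - y) ^ 2 * ((1 - u) * Real.exp (-(u * x + (1 - u) * y))) =
      (1 - (x - y) * (1 - 1)) * Real.exp (-(1 * x + (1 - 1) * y)) -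
      (1 - (x - y) * (1 - 0)) * Real.exp (-(0 * x + (1 - 0) * y)) := by
    -- The chosen `f` is an explicit primitive: its derivative is (x - y)² (1 - u) e^{-(ux +
    -- (1-u)y)}.
    refine intervalIntegral.integral_eq_sub_of_hasDerivAt (a := 0) (b := 1)
      (f := fun u => (1 - (x - y) * (1 - u)) * Real.exp (-(u * x + (1 - u) * y)))
      (fun u _ => ?_) ((intervalIntegrable_expRem x y).const_mul _)
    have h1 : HasDerivAt (fun u : ℝ => 1 - (x - y) * (1 - u)) (x - y) u := by
      have := (((hasDerivAt_id u).const_sub 1).const_mul (x - y)).const_sub 1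
      simpa using this
    have h2 : HasDerivAt (fun u : ℝ => -(u * x + (1 - u) * y)) (-(x - y)) u := by
      have := (((hasDerivAt_id' u).mul_const x).add
        (((hasDerivAt_id' u).const_sub 1).mul_const y)).neg
      exact this.congr_deriv (by ring)
    exact (h1.mul h2.exp).congr_deriv (by ring)
  rw [intervalIntegral.integral_const_mul] at h
  rw [expRem, h]
  norm_num
  ring

/-- Since v ≤ 1, v(1 + y) ≤ 1 + vy ≤ e^{vy}. With v = 1 - u this is the source of the decay 1/(1 +
y), which is summable over the free spectrum. -/
theorem mul_exp_neg_le {v y : ℝ} (hv1 : v ≤ 1) (hy : 0 ≤ y) :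
    v * Real.exp (-(v * y)) ≤ 1 / (1 + y) := by
  rw [Real.exp_neg, ← div_eq_mul_inv, div_le_div_iff₀ (Real.exp_pos _) (by linarith)]
  nlinarith [Real.add_one_le_exp (v * y)]

theorem abs_exp_sub_exp_le {a b c : ℝ} (ha : a ≤ c) (hb : b ≤ c) :
    |Real.exp a - Real.exp b| ≤ Real.exp c * |a - b| := by
  wlog hab : b ≤ a generalizing a b
  · rw [abs_sub_comm, abs_sub_comm a]
    exact this hb ha (le_of_not_ge hab)
  rw [abs_of_nonneg (sub_nonneg.2 (Real.exp_le_exp.2 hab)), abs_of_nonneg (sub_nonneg.2 hab)]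
  have h1 : Real.exp b = Real.exp a * Real.exp (b - a) := by rw [← Real.exp_add]; ring_nf
  have h2 := Real.add_one_le_exp (b - a)
  have h3 : 1 - Real.exp (b - a) ≤ a - b := by linarith
  calc Real.exp a - Real.exp b = Real.exp a * (1 - Real.exp (b - a)) := by rw [h1]; ring
    _ ≤ Real.exp a * (a - b) := by gcongr
    _ ≤ Real.exp c * (a - b) := by gcongr

theorem expRem_nonneg (x y : ℝ) : 0 ≤ expRem x y :=
  intervalIntegral.integral_nonneg zero_le_one fun u hu =>
    mul_nonneg (by linarith [hu.2]) (Real.exp_pos _).le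

theorem abs_expRem_le {x y c : ℝ} (hc : 0 ≤ c) (hx : -c ≤ x) (hy : 0 ≤ y) :
    |expRem x y| ≤ Real.exp c / (1 + y) := by
  have h := intervalIntegral.norm_integral_le_of_norm_le_const (a := 0) (b := 1)
    (C := Real.exp c / (1 + y)) (f := fun u => (1 - u) * Real.exp (-(u * x + (1 - u) * y))) ?_
  · simpa [expRem] using h
  intro u hu
  rw [Set.uIoc_of_le zero_le_one] at hu
  rw [Real.norm_of_nonneg (mul_nonneg (by linarith [hu.2]) (Real.exp_pos _).le), neg_add,
    Real.exp_add]
  have h1 : Real.exp (-(u * x)) ≤ Real.exp c := Real.exp_le_exp.2 (by nlinarith [hu.1, hu.2])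
  have h2 := mul_exp_neg_le (v := 1 - u) (y := y) (by linarith [hu.1]) hy
  calc (1 - u) * (Real.exp (-(u * x)) * Real.exp (-((1 - u) * y)))
      = Real.exp (-(u * x)) * ((1 - u) * Real.exp (-((1 - u) * y))) := by ring
    _ ≤ Real.exp c * (1 / (1 + y)) :=
        mul_le_mul h1 h2 (mul_nonneg (by linarith [hu.2]) (Real.exp_pos _).le) (Real.exp_pos _).le
    _ = Real.exp c / (1 + y) := by ring

/-- The Lipschitz bound keeps the decay in y. The factor |x - x'| will become a difference λ_n -
μ_p, hence a matrix element of the perturbation. -/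
theorem abs_expRem_sub_le {x x' y c : ℝ} (hc : 0 ≤ c) (hx : -c ≤ x) (hx' : -c ≤ x') (hy : 0 ≤ y) :
    |expRem x y - expRem x' y| ≤ Real.exp c / (1 + y) * |x - x'| := by
  rw [expRem, expRem, ← intervalIntegral.integral_sub (intervalIntegrable_expRem x y)
    (intervalIntegrable_expRem x' y)]
  have h := intervalIntegral.norm_integral_le_of_norm_le_const (a := 0) (b := 1)
    (C := Real.exp c / (1 + y) * |x - x'|)
    (f := fun u => (1 - u) * Real.exp (-(u * x + (1 - u) * y)) -
      (1 - u) * Real.exp (-(u * x' + (1 - u) * y))) ?_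
  · simpa using h
  intro u hu
  rw [Set.uIoc_of_le zero_le_one] at hu
  have h0 : (1 - u) * Real.exp (-(u * x + (1 - u) * y)) -
      (1 - u) * Real.exp (-(u * x' + (1 - u) * y)) =
      ((1 - u) * Real.exp (-((1 - u) * y))) * (Real.exp (-(u * x)) - Real.exp (-(u * x'))) := by
    rw [neg_add, neg_add, Real.exp_add, Real.exp_add]
    ring
  have h1 := abs_exp_sub_exp_le (a := -(u * x)) (b := -(u * x')) (c := c)
    (by nlinarith [hu.1, hu.2]) (by nlinarith [hu.1, hu.2])
  have h2 := mul_exp_neg_le (v := 1 - u) (y := y) (by linarith [hu.1]) hy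
  have h3 : |-(u * x) - -(u * x')| ≤ |x - x'| := by
    rw [show -(u * x) - -(u * x') = -(u * (x - x')) by ring, abs_neg, abs_mul, abs_of_pos hu.1]
    exact mul_le_of_le_one_left (abs_nonneg _) hu.2
  rw [h0, norm_mul, Real.norm_of_nonneg (mul_nonneg (by linarith [hu.2]) (Real.exp_pos _).le),
    Real.norm_eq_abs]
  calc (1 - u) * Real.exp (-((1 - u) * y)) * |Real.exp (-(u * x)) - Real.exp (-(u * x'))|
      ≤ 1 / (1 + y) * (Real.exp c * |x - x'|) := by
        refine mul_le_mul h2 (h1.trans ?_) (abs_nonneg _) (by positivity)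
        gcongr
    _ = Real.exp c / (1 + y) * |x - x'| := by ring

end ExponentialRemainder

/-! ### Second-order expansion of the trace for an abstract perturbation. -/

section TraceExpansion

variable {ι κ E : Type*} [NormedAddCommGroup E] [InnerProductSpace ℂ E]
  {b : HilbertBasis ι ℂ E} {μ : ι → ℝ} {W : E →L[ℂ] E}
  {φ : HilbertBasis κ ℂ E} {lam : κ → ℝ}

/-- This identity drives the expansion: each factor `lam n - μ m` can be traded for one application
of W. -/
theorem inner_perturbation_eigenvector (hφ : ∀ n, φ n ∈ pertEigenspace b μ W (lam n)) (m : ι)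
    (n : κ) : inner ℂ (b m) (W (φ n)) = ((lam n - μ m : ℝ) : ℂ) * inner ℂ (b m) (φ n) := by
  push_cast
  linear_combination mem_pertEigenspace.1 (hφ n) m

theorem inner_eigenvector_perturbation (hW : ∀ x y, inner ℂ (W x) y = inner ℂ x (W y))
    (hφ : ∀ n, φ n ∈ pertEigenspace b μ W (lam n)) (m : ι)
    (n : κ) : inner ℂ (φ n) (W (b m)) = ((lam n - μ m : ℝ) : ℂ) * inner ℂ (φ n) (b m) := by
  rw [← hW, ← inner_conj_symm, inner_perturbation_eigenvector hφ, map_mul, Complex.conj_ofReal,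
    inner_conj_symm]

theorem hasSum_basis_weighted_gap (hφ : ∀ n, φ n ∈ pertEigenspace b μ W (lam n)) (n : κ) :
    HasSum (fun m => (lam n - μ m) * ‖inner ℂ (b m) (φ n)‖ ^ 2)
      (inner ℂ (φ n) (W (φ n))).re := by
  have h := Complex.hasSum_re (b.hasSum_inner_mul_inner (φ n) (W (φ n)))
  convert h using 1
  funext m
  rw [inner_perturbation_eigenvector hφ, ← inner_conj_symm (φ n), mul_left_comm,
    ← Complex.normSq_eq_conj_mul_self, Complex.normSq_eq_norm_sq]
  norm_cast

theorem hasSum_eigenbasis_weighted_gap (hW : ∀ x y, inner ℂ (W x) y = inner ℂ x (W y))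
    (hφ : ∀ n, φ n ∈ pertEigenspace b μ W (lam n)) (m : ι) :
    HasSum (fun n => (lam n - μ m) * ‖inner ℂ (φ n) (b m)‖ ^ 2)
      (inner ℂ (b m) (W (b m))).re := by
  have h := Complex.hasSum_re (φ.hasSum_inner_mul_inner (b m) (W (b m)))
  convert h using 1
  funext n
  rw [inner_eigenvector_perturbation hW hφ, ← inner_conj_symm (b m), mul_left_comm,
    ← Complex.normSq_eq_conj_mul_self, Complex.normSq_eq_norm_sq]
  norm_cast

theorem abs_re_inner_eigenvector_le (n : κ) : |(inner ℂ (φ n) (W (φ n))).re| ≤ ‖W‖ := by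
  refine (Complex.abs_re_le_norm _).trans ((norm_inner_le_norm _ _).trans ?_)
  rw [φ.orthonormal.1 n, one_mul]
  simpa [φ.orthonormal.1 n] using W.le_opNorm (φ n)

theorem neg_norm_le_eigenvalue (hμ0 : ∀ m, 0 ≤ μ m)
    (hφ : ∀ n, φ n ∈ pertEigenspace b μ W (lam n)) (n : κ) : -‖W‖ ≤ lam n := by
  have h1 := hasSum_basis_weighted_gap hφ n
  have h2 := (hasSum_norm_inner_sq b (φ n)).mul_left (lam n)
  rw [φ.orthonormal.1 n] at h2
  have h3 := hasSum_le (fun m => by nlinarith [hμ0 m, sq_nonneg ‖inner ℂ (b m) (φ n)‖]) h1 h2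
  have h4 := neg_le_of_abs_le (abs_re_inner_eigenvector_le (W := W) (φ := φ) n)
  linarith

/-- Jensen's inequality for the spectral measure of an eigenvector. -/
theorem summable_exp_neg_eigenvalue
    (hs : Summable fun m => Real.exp (-μ m))
    (hφ : ∀ n, φ n ∈ pertEigenspace b μ W (lam n)) :
    Summable fun n => Real.exp (-lam n) := by
  have hF : Summable fun p : ι × κ => Real.exp (-μ p.1) * ‖inner ℂ (φ p.2) (b p.1)‖ ^ 2 := by
    rw [summable_prod_of_nonneg fun p => by positivity]
    have h : ∀ m, HasSum (fun n => Real.exp (-μ m) * ‖inner ℂ (φ n) (b m)‖ ^ 2)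
        (Real.exp (-μ m)) := fun m => by
      simpa [b.orthonormal.1 m] using (hasSum_norm_inner_sq φ (b m)).mul_left (Real.exp (-μ m))
    exact ⟨fun m => (h m).summable, by simpa only [(h _).tsum_eq] using hs⟩
  have hF' := hF.prod_symm
  refine Summable.of_nonneg_of_le (fun n => (Real.exp_pos _).le) (fun n => ?_)
    (hF'.prod.mul_left (Real.exp ‖W‖))
  -- `lam n - w` is the mean of μ under the weights |⟨b m, φ n⟩|², which sum to 1.
  set w := (inner ℂ (φ n) (W (φ n))).re with hw
  have h1 := hasSum_basis_weighted_gap hφ n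
  have h2 := hasSum_norm_inner_sq b (φ n)
  rw [φ.orthonormal.1 n, one_pow] at h2
  have h3 := (h2.mul_left (1 - w)).add h1
  have h4 := h3.mul_left (Real.exp (-(lam n - w)))
  have h5 := hasSum_le (fun m => ?_) h4 (hF'.prod_factor n).hasSum
  · have h6 : Real.exp (-(lam n - w)) ≤ ∑' m, Real.exp (-μ m) * ‖inner ℂ (φ n) (b m)‖ ^ 2 := by
      refine le_trans (le_of_eq ?_) h5
      ring
    have h7 := abs_re_inner_eigenvector_le (W := W) (φ := φ) n
    calc Real.exp (-lam n) ≤ Real.exp (‖W‖ + -(lam n - w)) :=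
          Real.exp_le_exp.2 (by linarith [neg_le_of_abs_le h7])
      _ = Real.exp ‖W‖ * Real.exp (-(lam n - w)) := Real.exp_add _ _
      _ ≤ _ := mul_le_mul_of_nonneg_left h6 (Real.exp_pos _).le
  · simp only [Prod.swap]
    rw [← norm_inner_symm (φ n)]
    -- The exponential lies above its tangent at the mean `-(lam n - w)`; averaging cancels the
    -- linear part.
    have h8 := Real.add_one_le_exp (-μ m + (lam n - w))
    rw [Real.exp_add] at h8
    have h9 : Real.exp (-(lam n - w)) * (1 - w + (lam n - μ m)) ≤ Real.exp (-μ m) := by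
      rw [Real.exp_neg, ← div_eq_inv_mul, div_le_iff₀ (Real.exp_pos _)]
      linarith
    calc _ = Real.exp (-(lam n - w)) * (1 - w + (lam n - μ m)) * ‖inner ℂ (φ n) (b m)‖ ^ 2 := by ring
      _ ≤ _ := by gcongr

/-- The trace of e^{-(D+W)} is the same computed in `b` or in `φ`: Parseval in each index, and an
exchange of sums of nonnegative terms. -/
theorem hasSum_heat_diagonal (hs : Summable fun n => Real.exp (-lam n)) :
    HasSum (fun m => ∑' n, Real.exp (-lam n) * ‖inner ℂ (φ n) (b m)‖ ^ 2)
      (∑' n, Real.exp (-lam n)) := by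
  have h : ∀ n, HasSum (fun m => Real.exp (-lam n) * ‖inner ℂ (φ n) (b m)‖ ^ 2)
      (Real.exp (-lam n)) := fun n => by
    simpa [φ.orthonormal.1 n, norm_inner_symm] using
      (hasSum_norm_inner_sq b (φ n)).mul_left (Real.exp (-lam n))
  have hF : Summable fun p : κ × ι => Real.exp (-lam p.1) * ‖inner ℂ (φ p.1) (b p.2)‖ ^ 2 := by
    rw [summable_prod_of_nonneg fun p => by positivity]
    exact ⟨fun n => (h n).summable, by simpa only [(h _).tsum_eq] using hs⟩
  have h2 := hF.tsum_comm' (fun n => (h n).summable) (fun m => hF.prod_symm.prod_factor m)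
  simp only [(h _).tsum_eq] at h2
  rw [← h2]
  exact hF.prod_symm.prod.hasSum

/-- Expand e^{-λ_n} about μ_m and sum over n: Parseval gives the constant term, the weighted gap
gives the linear one, and (λ_n - μ_m)² |⟨φ_n, b_m⟩|² = |⟨φ_n, W b_m⟩|² gives the last. -/
theorem heat_diagonal_eq (hW : ∀ x y, inner ℂ (W x) y = inner ℂ x (W y)) (hμ0 : ∀ m, 0 ≤ μ m)
    (hφ : ∀ n, φ n ∈ pertEigenspace b μ W (lam n)) (m : ι) :
    ∑' n, Real.exp (-lam n) * ‖inner ℂ (φ n) (b m)‖ ^ 2 =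
      Real.exp (-μ m) * (1 - (inner ℂ (b m) (W (b m))).re) +
      ∑' n, expRem (lam n) (μ m) * ‖inner ℂ (φ n) (W (b m))‖ ^ 2 := by
  have h1 := (hasSum_norm_inner_sq φ (b m)).mul_left (Real.exp (-μ m))
  have h2 := (hasSum_eigenbasis_weighted_gap hW hφ m).mul_left (-Real.exp (-μ m))
  have h3 : Summable fun n => expRem (lam n) (μ m) * ‖inner ℂ (φ n) (W (b m))‖ ^ 2 := by
    refine Summable.of_nonneg_of_le (fun n => mul_nonneg (expRem_nonneg _ _) (by positivity))
      (fun n => ?_) ((hasSum_norm_inner_sq φ (W (b m))).summable.mul_left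
        (Real.exp ‖W‖ / (1 + μ m)))
    gcongr
    exact (le_abs_self _).trans
      (abs_expRem_le (norm_nonneg W) (neg_norm_le_eigenvalue hμ0 hφ n) (hμ0 m))
  rw [b.orthonormal.1 m] at h1
  have h4 := ((h1.add h2).add h3.hasSum).tsum_eq
  rw [show Real.exp (-μ m) * (1 - (inner ℂ (b m) (W (b m))).re) =
    Real.exp (-μ m) * 1 ^ 2 + -Real.exp (-μ m) * (inner ℂ (b m) (W (b m))).re by ring, ← h4]
  refine tsum_congr fun n => ?_
  rw [inner_eigenvector_perturbation hW hφ, norm_mul, mul_pow, Complex.norm_real,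
    Real.norm_eq_abs, sq_abs]
  linear_combination ‖inner ℂ (φ n) (b m)‖ ^ 2 * exp_neg_eq_add_expRem (lam n) (μ m)

/-- With g = `expRem · y`, the sums are ⟨v, g(D+W) v⟩ and ⟨v, g(D) v⟩. The matrix elements of the
difference are (g(λ_n) - g(μ_p))⟨φ_n, b_p⟩, at most a constant times |⟨φ_n, W b_p⟩|. This controls
the difference on each b_p, and absolute summability of the coefficients of v carries the bound to
v. -/
theorem abs_tsum_expRem_sub_le (hW : ∀ x y, inner ℂ (W x) y = inner ℂ x (W y))
    (hμ0 : ∀ m, 0 ≤ μ m) (hφ : ∀ n, φ n ∈ pertEigenspace b μ W (lam n)) {y : ℝ} (hy : 0 ≤ y)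
    (v : E) (hv : Summable fun p => ‖inner ℂ (b p) v‖) :
    |∑' n, expRem (lam n) y * ‖inner ℂ (φ n) v‖ ^ 2 -
      ∑' p, expRem (μ p) y * ‖inner ℂ (b p) v‖ ^ 2| ≤
      Real.exp ‖W‖ / (1 + y) * ‖W‖ * ‖v‖ * ∑' p, ‖inner ℂ (b p) v‖ := by
  classical
  set B := Real.exp ‖W‖ / (1 + y) with hB
  have hB0 : 0 ≤ B := by positivity
  have hlam := neg_norm_le_eigenvalue hμ0 hφ
  have hmu : ∀ p, -‖W‖ ≤ μ p := fun p => by linarith [hμ0 p, norm_nonneg W]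
  obtain ⟨M, hM, -⟩ := exists_diagonal φ (fun n => expRem (lam n) y) hB0
    (fun n => abs_expRem_le (norm_nonneg W) (hlam n) hy)
  obtain ⟨M₀, hM₀, -⟩ := exists_diagonal b (fun p => expRem (μ p) y) hB0
    (fun p => abs_expRem_le (norm_nonneg W) (hmu p) hy)
  rw [(hasSum_inner_diagonal φ hM v).tsum_eq, (hasSum_inner_diagonal b hM₀ v).tsum_eq,
    ← Complex.sub_re, ← inner_sub_right]
  have hbasis : ∀ p, ‖(M - M₀) (b p)‖ ≤ B * ‖W‖ := by
    intro p
    have h1 : ‖(M - M₀) (b p)‖ ≤ B * ‖W (b p)‖ := by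
      refine norm_le_of_norm_inner_le φ hB0 fun n => ?_
      rw [inner_eigenvector_perturbation hW hφ, sub_apply, inner_sub_right, hM,
        diagonal_apply_basis b hM₀, inner_smul_right, ← sub_mul, norm_mul, norm_mul, ← mul_assoc]
      gcongr
      rw [← Complex.ofReal_sub, Complex.norm_real, Complex.norm_real, Real.norm_eq_abs,
        Real.norm_eq_abs]
      exact abs_expRem_sub_le (norm_nonneg W) (hlam n) (hmu p) hy
    have h2 := W.le_opNorm (b p)
    rw [b.orthonormal.1 p, mul_one] at h2
    exact h1.trans (by gcongr)
  have hsum : ‖(M - M₀) v‖ ≤ B * ‖W‖ * ∑' p, ‖inner ℂ (b p) v‖ := by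
    have h1 := (M - M₀).hasSum (b.hasSum_repr v)
    rw [← h1.tsum_eq]
    refine tsum_of_norm_bounded (hv.hasSum.mul_left (B * ‖W‖)) fun p => ?_
    rw [map_smul, norm_smul, b.repr_apply_apply, mul_comm]
    gcongr
    exact hbasis p
  calc |(inner ℂ v (M v - M₀ v)).re| ≤ ‖v‖ * ‖(M - M₀) v‖ :=
        (Complex.abs_re_le_norm _).trans (norm_inner_le_norm _ _)
    _ ≤ ‖v‖ * (B * ‖W‖ * ∑' p, ‖inner ℂ (b p) v‖) := by gcongr
    _ = _ := by ring

/-- Second-order expansion of the trace of `exp (-(D + W))`, with a cubic remainder. -/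
theorem abs_heat_trace_sub_le (hW : ∀ x y, inner ℂ (W x) y = inner ℂ x (W y))
    (hμ0 : ∀ m, 0 ≤ μ m) (hs : Summable fun m => Real.exp (-μ m))
    (hs' : Summable fun m => 1 / (1 + μ m)) (hφ : ∀ n, φ n ∈ pertEigenspace b μ W (lam n))
    {K : ℝ} (hK : ‖W‖ ≤ K) (hcol : ∀ m, Summable fun p => ‖inner ℂ (b p) (W (b m))‖)
    (hcolK : ∀ m, ∑' p, ‖inner ℂ (b p) (W (b m))‖ ≤ K) :
    (Summable fun m => Real.exp (-μ m) * (1 - (inner ℂ (b m) (W (b m))).re) +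
        ∑' p, expRem (μ p) (μ m) * ‖inner ℂ (b p) (W (b m))‖ ^ 2) ∧
    |∑' n, Real.exp (-lam n) -
      ∑' m, (Real.exp (-μ m) * (1 - (inner ℂ (b m) (W (b m))).re) +
        ∑' p, expRem (μ p) (μ m) * ‖inner ℂ (b p) (W (b m))‖ ^ 2)| ≤
      K ^ 3 * (Real.exp K * ∑' m, 1 / (1 + μ m)) := by
  have hK0 : 0 ≤ K := (norm_nonneg W).trans hK
  have hT := hasSum_heat_diagonal (b := b) (φ := φ) (summable_exp_neg_eigenvalue hs hφ)
  simp only [heat_diagonal_eq hW hμ0 hφ] at hT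
  have hr : ∀ m, ‖(∑' n, expRem (lam n) (μ m) * ‖inner ℂ (φ n) (W (b m))‖ ^ 2 -
      ∑' p, expRem (μ p) (μ m) * ‖inner ℂ (b p) (W (b m))‖ ^ 2)‖ ≤
      K ^ 3 * Real.exp K * (1 / (1 + μ m)) := by
    intro m
    have h0 := hμ0 m
    have h1 := abs_tsum_expRem_sub_le hW hμ0 hφ (hμ0 m) (W (b m)) (hcol m)
    have h2 := W.le_opNorm (b m)
    rw [b.orthonormal.1 m, mul_one] at h2
    refine h1.trans ?_
    calc Real.exp ‖W‖ / (1 + μ m) * ‖W‖ * ‖W (b m)‖ * ∑' p, ‖inner ℂ (b p) (W (b m))‖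
        ≤ Real.exp K / (1 + μ m) * K * K * K := by
          have := h2.trans hK
          have := hcolK m
          have : 0 ≤ ∑' p, ‖inner ℂ (b p) (W (b m))‖ := tsum_nonneg fun _ => norm_nonneg _
          gcongr
      _ = K ^ 3 * Real.exp K * (1 / (1 + μ m)) := by ring
  have hrs := Summable.of_norm_bounded (hs'.mul_left (K ^ 3 * Real.exp K)) hr
  have hmain := hT.summable.sub hrs
  have hmain' : Summable fun m => Real.exp (-μ m) * (1 - (inner ℂ (b m) (W (b m))).re) +
        ∑' p, expRem (μ p) (μ m) * ‖inner ℂ (b p) (W (b m))‖ ^ 2 := by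
    exact hmain.congr fun m => by ring
  refine ⟨hmain', ?_⟩
  rw [← hT.tsum_eq, ← hT.summable.tsum_sub hmain']
  have h := tsum_of_norm_bounded (hs'.mul_left (K ^ 3 * Real.exp K)).hasSum hr
  rw [tsum_mul_left, mul_assoc, Real.norm_eq_abs] at h
  refine le_trans (le_of_eq ?_) h
  congr 1
  exact tsum_congr fun m => by ring

end TraceExpansion

end CircleHeat

namespace CircleHeat

/-! ### Poisson summation for θ and β_k, and the limit of large radius. -/

section ThetaBeta

theorem hasSum_intervalIntegral_of_norm_le {ι F : Type*} [Countable ι] [NormedAddCommGroup F]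
    [NormedSpace ℝ F] [CompleteSpace F] {f : ι → ℝ → F} {u : ι → ℝ} {a b : ℝ}
    (hf : ∀ i, Continuous (f i)) (hu : Summable u) (hfu : ∀ i, ∀ x ∈ Set.uIcc a b, ‖f i x‖ ≤ u i) :
    HasSum (fun i => ∫ x in a..b, f i x) (∫ x in a..b, ∑' i, f i x) := by
  refine intervalIntegral.hasSum_integral_of_dominated_convergence (fun i _ => u i)
    (fun i => (hf i).aestronglyMeasurable) (fun i => Eventually.of_forall fun x hx =>
      hfu i x (Set.uIoc_subset_uIcc hx)) (Eventually.of_forall fun _ _ => hu) (by simp)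
    (Eventually.of_forall fun x hx => Summable.hasSum ?_)
  exact Summable.of_norm_bounded hu fun i => hfu i x (Set.uIoc_subset_uIcc hx)

theorem summable_exp_neg_mul_int_sq {s : ℝ} (hs : 0 < s) :
    Summable fun n : ℤ => Real.exp (-(s * (n : ℝ) ^ 2)) := by
  have h := summable_pow_mul_jacobiTheta₂_term_bound 0 (T := s / Real.pi) (by positivity) 0
  refine h.congr fun n => ?_
  rw [pow_zero, one_mul]
  congr 1
  field_simp
  ring

theorem summable_theta {s : ℝ} (hs : 0 < s) :
    Summable fun n : ℤ => Real.exp (-(1 / s * Real.pi ^ 2 * (n : ℝ) ^ 2)) :=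
  summable_exp_neg_mul_int_sq (s := 1 / s * Real.pi ^ 2) (by positivity)

theorem rpow_half_inv_pi_div (s : ℝ) :
    1 / (Real.pi / s) ^ (1 / 2 : ℝ) = Real.sqrt s / Real.sqrt Real.pi := by
  rw [← Real.sqrt_eq_rpow, Real.sqrt_div Real.pi_pos.le, one_div_div]

theorem theta_eq {s : ℝ} (hs : 0 < s) :
    theta s = Real.sqrt s / Real.sqrt Real.pi * ∑' n : ℤ, Real.exp (-(s * (n : ℝ) ^ 2)) := by
  have h := Real.tsum_exp_neg_mul_int_sq (a := Real.pi / s) (by positivity)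
  rw [rpow_half_inv_pi_div s] at h
  have h1 : ∀ n : ℤ, Real.exp (-Real.pi * (Real.pi / s) * (n : ℝ) ^ 2) =
      Real.exp (-(1 / s * Real.pi ^ 2 * (n : ℝ) ^ 2)) := fun n => by congr 1; ring
  have h2 : ∀ n : ℤ, Real.exp (-Real.pi / (Real.pi / s) * (n : ℝ) ^ 2) =
      Real.exp (-(s * (n : ℝ) ^ 2)) := fun n => by
    congr 1
    field_simp
  rw [theta]
  simpa only [h1, h2] using h

theorem norm_betaTerm (k : ℤ) (s ξ : ℝ) (n : ℤ) : ‖betaTerm k s ξ n‖ =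
    Real.exp (-((1 - ξ ^ 2) / 4 * (s * (k : ℝ) ^ 2))) *
      Real.exp (-(1 / s * Real.pi ^ 2 * (n : ℝ) ^ 2)) := by
  rw [← Real.exp_add, betaTerm, Complex.norm_exp]
  congr 1
  have : (-(s * ((1 - ξ ^ 2) / 4) * k ^ 2) - 1 / s * Real.pi ^ 2 * n ^ 2
    - I * k * n * (1 + ξ) * Real.pi : ℂ) = ((-((1 - ξ ^ 2) / 4 * (s * (k : ℝ) ^ 2)) +
      -(1 / s * Real.pi ^ 2 * (n : ℝ) ^ 2) : ℝ) : ℂ) +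
      ((-(k * n * (1 + ξ) * Real.pi) : ℝ) : ℂ) * I := by
    push_cast
    ring
  rw [this, Complex.add_re, Complex.ofReal_re, Complex.re_ofReal_mul, Complex.I_re, mul_zero,
    add_zero]

theorem norm_betaTerm_le {s ξ : ℝ} (hs : 0 < s) (hξ : ξ ∈ Set.Icc (0 : ℝ) 1) (k n : ℤ) :
    ‖betaTerm k s ξ n‖ ≤ Real.exp (-(1 / s * Real.pi ^ 2 * (n : ℝ) ^ 2)) := by
  rw [norm_betaTerm]
  refine mul_le_of_le_one_left (Real.exp_pos _).le (Real.exp_le_one_iff.2 ?_)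
  have : 0 ≤ (1 - ξ ^ 2) / 4 := by nlinarith [hξ.1, hξ.2]
  have : 0 ≤ (1 - ξ ^ 2) / 4 * (s * (k : ℝ) ^ 2) := by positivity
  linarith

theorem continuous_betaTerm (k : ℤ) (s : ℝ) (n : ℤ) : Continuous fun ξ => betaTerm k s ξ n := by
  unfold betaTerm
  fun_prop

theorem summable_betaTerm {s ξ : ℝ} (hs : 0 < s) (hξ : ξ ∈ Set.Icc (0 : ℝ) 1) (k : ℤ) :
    Summable (betaTerm k s ξ) :=
  Summable.of_norm_bounded (summable_theta hs) (norm_betaTerm_le hs hξ k)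

theorem intervalIntegrable_tsum_betaTerm {s : ℝ} (hs : 0 < s) (k : ℤ) :
    IntervalIntegrable (fun ξ : ℝ => ∑' n : ℤ, betaTerm k s ξ n) MeasureTheory.volume 0 1 := by
  refine ContinuousOn.intervalIntegrable ?_
  rw [Set.uIcc_of_le zero_le_one]
  exact continuousOn_tsum (fun n => (continuous_betaTerm k s n).continuousOn) (summable_theta hs)
    fun n ξ hξ => norm_betaTerm_le hs hξ k n

/-- The summand interpolating between the free heat kernels at `m + k` and at `m`. -/
noncomputable def pathTerm (k : ℤ) (s u : ℝ) (m : ℤ) : ℝ :=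
  Real.exp (-(u * (s * ((m : ℝ) + k) ^ 2) + (1 - u) * (s * (m : ℝ) ^ 2)))

/-- The exponent is -s(m² + 2umk + uk²), and completing the square bounds the bracket below by m²/2
- k². The majorant is free of u, as needed for continuity and for integration term by term. -/
theorem pathTerm_le {s u : ℝ} (hs : 0 < s) (hu : u ∈ Set.Icc (0 : ℝ) 1) (k m : ℤ) :
    pathTerm k s u m ≤ Real.exp (s * (k : ℝ) ^ 2) * Real.exp (-(s / 2 * (m : ℝ) ^ 2)) := by
  rw [pathTerm, ← Real.exp_add, Real.exp_le_exp]
  have h1 : u * ((m : ℝ) + k) ^ 2 + (1 - u) * (m : ℝ) ^ 2 ≥ (m : ℝ) ^ 2 / 2 - (k : ℝ) ^ 2 := by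
    have h2 : 0 ≤ (1 - u) * (k : ℝ) ^ 2 := mul_nonneg (by linarith [hu.2]) (sq_nonneg _)
    have h3 : 0 ≤ u * (1 - u) * (k : ℝ) ^ 2 :=
      mul_nonneg (mul_nonneg hu.1 (by linarith [hu.2])) (sq_nonneg _)
    have h4 : 0 ≤ (1 - u) * (1 + u) * (k : ℝ) ^ 2 :=
      mul_nonneg (mul_nonneg (by linarith [hu.2]) (by linarith [hu.1])) (sq_nonneg _)
    nlinarith [sq_nonneg ((m : ℝ) + 2 * u * k)]
  nlinarith [mul_le_mul_of_nonneg_left h1.le hs.le]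

theorem pathTerm_nonneg (k : ℤ) (s u : ℝ) (m : ℤ) : 0 ≤ pathTerm k s u m := (Real.exp_pos _).le

theorem continuous_pathTerm (k : ℤ) (s : ℝ) (m : ℤ) : Continuous fun u => pathTerm k s u m := by
  unfold pathTerm
  fun_prop

theorem summable_pathBound {s : ℝ} (hs : 0 < s) (k : ℤ) : Summable fun m : ℤ =>
    Real.exp (s * (k : ℝ) ^ 2) * Real.exp (-(s / 2 * (m : ℝ) ^ 2)) :=
  (summable_exp_neg_mul_int_sq (by positivity)).mul_left _

theorem summable_pathTerm {s u : ℝ} (hs : 0 < s) (hu : u ∈ Set.Icc (0 : ℝ) 1) (k : ℤ) :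
    Summable (pathTerm k s u) :=
  Summable.of_nonneg_of_le (pathTerm_nonneg k s u) (pathTerm_le hs hu k) (summable_pathBound hs k)

theorem continuousOn_tsum_pathTerm {s : ℝ} (hs : 0 < s) (k : ℤ) :
    ContinuousOn (fun u => ∑' m, pathTerm k s u m) (Set.Icc 0 1) :=
  continuousOn_tsum (fun n => (continuous_pathTerm k s n).continuousOn) (summable_pathBound hs k)
    fun n u hu => by
      rw [Real.norm_of_nonneg (pathTerm_nonneg k s u n)]
      exact pathTerm_le hs hu k n

/-- The reflection m ↦ -k - m exchanges m² and (m + k)². -/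
theorem tsum_pathTerm_one_sub (k : ℤ) (s u : ℝ) :
    ∑' m, pathTerm k s (1 - u) m = ∑' m, pathTerm k s u m := by
  rw [← (Equiv.subLeft (-k)).tsum_eq (pathTerm k s u)]
  refine tsum_congr fun m => ?_
  simp only [pathTerm, Equiv.subLeft_apply]
  congr 1
  push_cast
  ring

theorem betaDualTerm_add (k : ℤ) (s ξ : ℝ) (m : ℤ) :
    betaDualTerm k s ξ (m + k) = pathTerm k s ((1 - ξ) / 2) m := by
  simp only [betaDualTerm, pathTerm]
  congr 1
  push_cast
  ring

theorem half_mem {ξ : ℝ} (hξ : ξ ∈ Set.Icc (0 : ℝ) 1) : (1 - ξ) / 2 ∈ Set.Icc (0 : ℝ) 1 :=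
  ⟨by linarith [hξ.2], by linarith [hξ.1]⟩

theorem summable_betaDualTerm {s ξ : ℝ} (hs : 0 < s) (hξ : ξ ∈ Set.Icc (0 : ℝ) 1) (k : ℤ) :
    Summable (betaDualTerm k s ξ) := by
  rw [← (Equiv.addRight k).summable_iff]
  exact (summable_pathTerm hs (half_mem hξ) k).congr fun m => (betaDualTerm_add k s ξ m).symm

theorem tsum_betaDualTerm (k : ℤ) (s ξ : ℝ) :
    ∑' n, betaDualTerm k s ξ n = ∑' m, pathTerm k s ((1 - ξ) / 2) m := by
  rw [← (Equiv.addRight k).tsum_eq]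
  exact tsum_congr fun m => betaDualTerm_add k s ξ m

theorem intervalIntegrable_tsum_betaDualTerm {s : ℝ} (hs : 0 < s) (k : ℤ) :
    IntervalIntegrable (fun ξ : ℝ => ∑' n : ℤ, betaDualTerm k s ξ n) MeasureTheory.volume 0 1 := by
  refine ContinuousOn.intervalIntegrable ?_
  rw [Set.uIcc_of_le zero_le_one]
  simp only [tsum_betaDualTerm]
  exact (continuousOn_tsum_pathTerm hs k).comp (by fun_prop) fun ξ hξ => half_mem hξ

/-- Poisson summation for a Gaussian with linear term -ikn(1+ξ)π. The dual Gaussian is centred at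
-k(1+ξ)/2, and the prefactor e^{-s(1-ξ²)k²/4} completes its square to the dual exponent, after n ↦
-n. -/
theorem tsum_betaTerm {s : ℝ} (hs : 0 < s) (k : ℤ) (ξ : ℝ) :
    ∑' n, betaTerm k s ξ n =
      ((Real.sqrt s / Real.sqrt Real.pi * ∑' n, betaDualTerm k s ξ n : ℝ) : ℂ) := by
  have h := Complex.tsum_exp_neg_quadratic (a := ((Real.pi / s : ℝ) : ℂ))
    (by rw [Complex.ofReal_re]; positivity) (-I * k * (1 + ξ) / 2)
  have hc : (1 : ℂ) / ((Real.pi / s : ℝ) : ℂ) ^ (1 / 2 : ℂ) =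
      ((Real.sqrt s / Real.sqrt Real.pi : ℝ) : ℂ) := by
    rw [← rpow_half_inv_pi_div s, Complex.ofReal_div 1, Complex.ofReal_cpow (by positivity)]
    norm_num
  rw [hc] at h
  set c : ℂ := cexp (-(s * ((1 - ξ ^ 2) / 4) * k ^ 2))
  have hπ : (Real.pi : ℂ) ≠ 0 := by exact_mod_cast Real.pi_ne_zero
  have hs' : (s : ℂ) ≠ 0 := by exact_mod_cast hs.ne'
  have h1 : ∀ n : ℤ, betaTerm k s ξ n = c * cexp (-Real.pi * ((Real.pi / s : ℝ) : ℂ) * n ^ 2 +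
      2 * Real.pi * (-I * k * (1 + ξ) / 2) * n) := by
    intro n
    rw [← Complex.exp_add, betaTerm]
    congr 1
    push_cast
    ring
  have h2 : ∀ n : ℤ, ((betaDualTerm k s ξ (-n) : ℝ) : ℂ) =
      c * cexp (-Real.pi / ((Real.pi / s : ℝ) : ℂ) * (n + I * (-I * k * (1 + ξ) / 2)) ^ 2) := by
    intro n
    rw [← Complex.exp_add, betaDualTerm, Complex.ofReal_exp]
    congr 1
    have h3 : -(Real.pi : ℂ) / ((Real.pi / s : ℝ) : ℂ) = -s := by
      push_cast
      field_simp
    have h4 : I * (-I * k * (1 + ξ) / 2) = (k * (1 + ξ) / 2 : ℂ) := by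
      linear_combination (-(k : ℂ) * (1 + ξ) / 2) * Complex.I_mul_I
    rw [h3, h4]
    push_cast
    ring
  rw [tsum_congr h1, tsum_mul_left, h, ← (Equiv.neg ℤ).tsum_eq (betaDualTerm k s ξ)]
  simp only [Complex.ofReal_mul, Complex.ofReal_tsum, Equiv.neg_apply, h2]
  rw [tsum_mul_left]
  ring

theorem beta_eq {s : ℝ} (hs : 0 < s) (k : ℤ) :
    beta k s = ((Real.sqrt s / Real.sqrt Real.pi *
      ∫ ξ in (0 : ℝ)..1, ∑' n : ℤ, betaDualTerm k s ξ n : ℝ) : ℂ) := by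
  rw [beta]
  simp only [tsum_betaTerm hs]
  rw [intervalIntegral.integral_ofReal, intervalIntegral.integral_const_mul]

/-- Summing under the integral gives ∫ (1 - u) H(u) du with H(1 - u) = H(u). Symmetry replaces the
weight 1 - u by its mean 1/2, and folds [0, 1] onto [0, 1/2], parametrised by u = (1 - ξ)/2. -/
theorem hasSum_expRem {s : ℝ} (hs : 0 < s) (k : ℤ) :
    HasSum (fun m : ℤ => expRem (s * ((m : ℝ) + k) ^ 2) (s * (m : ℝ) ^ 2))
      (1 / 2 * ∫ ξ in (0 : ℝ)..1, ∑' n : ℤ, betaDualTerm k s ξ n) := by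
  set H : ℝ → ℝ := fun u => ∑' m, pathTerm k s u m with hH
  have hHc : ContinuousOn H (Set.Icc 0 1) := continuousOn_tsum_pathTerm hs k
  have hsub : ∀ u, H (1 - u) = H u := tsum_pathTerm_one_sub k s
  have hint : ∀ a ∈ Set.Icc (0 : ℝ) 1, ∀ b ∈ Set.Icc (0 : ℝ) 1, ∀ f : ℝ → ℝ, Continuous f →
      IntervalIntegrable (fun u => f u * H u) MeasureTheory.volume a b := by
    intro a ha b hb f hf
    refine ContinuousOn.intervalIntegrable (hf.continuousOn.mul (hHc.mono ?_))
    exact Set.uIcc_subset_Icc ha hb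
  have h0 : (0 : ℝ) ∈ Set.Icc (0 : ℝ) 1 := by simp
  have h1 : (1 : ℝ) ∈ Set.Icc (0 : ℝ) 1 := by simp
  have hhalf : (1 / 2 : ℝ) ∈ Set.Icc (0 : ℝ) 1 := by constructor <;> norm_num
  have hmain := hasSum_intervalIntegral_of_norm_le (a := 0) (b := 1)
    (f := fun (m : ℤ) (u : ℝ) => (1 - u) * pathTerm k s u m)
    (fun m => (by fun_prop : Continuous fun u : ℝ => 1 - u).mul (continuous_pathTerm k s m))
    (summable_pathBound hs k) (fun m u hu => by
      rw [Set.uIcc_of_le zero_le_one] at hu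
      rw [Real.norm_of_nonneg (mul_nonneg (by linarith [hu.2]) (pathTerm_nonneg k s u m))]
      exact (mul_le_of_le_one_left (pathTerm_nonneg k s u m) (by linarith [hu.1])).trans
        (pathTerm_le hs hu k m))
  have hval : ∫ u in (0 : ℝ)..1, ∑' m, (1 - u) * pathTerm k s u m =
      1 / 2 * ∫ ξ in (0 : ℝ)..1, ∑' n : ℤ, betaDualTerm k s ξ n := by
    simp only [tsum_mul_left, tsum_betaDualTerm]
    change ∫ u in (0 : ℝ)..1, (1 - u) * H u = 1 / 2 * ∫ ξ in (0 : ℝ)..1, H ((1 - ξ) / 2)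
    have e1 : ∫ u in (0 : ℝ)..1, u * H u = ∫ u in (0 : ℝ)..1, (1 - u) * H u := by
      have := intervalIntegral.integral_comp_sub_left (a := 0) (b := 1) (fun u => u * H u) 1
      simp only [hsub, sub_self, sub_zero] at this
      exact this.symm
    have e2 : (∫ u in (0 : ℝ)..1, u * H u) + ∫ u in (0 : ℝ)..1, (1 - u) * H u =
        ∫ u in (0 : ℝ)..1, H u := by
      rw [← intervalIntegral.integral_add (hint 0 h0 1 h1 (fun u => u) continuous_id)
        (hint 0 h0 1 h1 (fun u => 1 - u) (by fun_prop))]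
      refine intervalIntegral.integral_congr fun u _ => ?_
      ring
    have hint1 : ∀ a ∈ Set.Icc (0 : ℝ) 1, ∀ b ∈ Set.Icc (0 : ℝ) 1,
        IntervalIntegrable H MeasureTheory.volume a b := fun a ha b hb => by
      simpa using hint a ha b hb (fun _ => 1) continuous_const
    have e3 : ∫ u in (0 : ℝ)..1, H u = 2 * ∫ u in (0 : ℝ)..(1 / 2), H u := by
      have h := intervalIntegral.integral_add_adjacent_intervals (hint1 0 h0 _ hhalf)
        (hint1 _ hhalf 1 h1)
      have h' := intervalIntegral.integral_comp_sub_left (a := 0) (b := 1 / 2) H 1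
      simp only [hsub, sub_zero] at h'
      rw [show (1 : ℝ) - 1 / 2 = 1 / 2 by norm_num] at h'
      linarith
    have e4 : ∫ ξ in (0 : ℝ)..1, H ((1 - ξ) / 2) = 2 * ∫ u in (0 : ℝ)..(1 / 2), H u := by
      have h := intervalIntegral.integral_comp_sub_div (a := 0) (b := 1) H (two_ne_zero' ℝ) (1 / 2)
      simp only [sub_self, zero_div, sub_zero, smul_eq_mul] at h
      rw [← h]
      refine intervalIntegral.integral_congr fun u _ => ?_
      congr 1
      ring
    linarith
  rw [← hval]
  exact hmain

theorem norm_beta_le {s : ℝ} (hs : 0 < s) (k : ℤ) : ‖beta k s‖ ≤ theta s := by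
  have h := intervalIntegral.norm_integral_le_of_norm_le_const (a := 0) (b := 1) (C := theta s)
    (f := fun ξ : ℝ => ∑' n : ℤ, betaTerm k s ξ n) ?_
  · simpa [beta] using h
  intro ξ hξ
  rw [Set.uIoc_of_le zero_le_one] at hξ
  exact tsum_of_norm_bounded (summable_theta hs).hasSum
    (norm_betaTerm_le hs (Set.Ioc_subset_Icc_self hξ) k)

theorem alpha_pos (z : ℝ) : 0 < alpha z := by
  refine intervalIntegral.intervalIntegral_pos_of_pos (Continuous.intervalIntegrable (by fun_prop) _ _)
    (fun ξ => Real.exp_pos _) zero_lt_one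

/-- The n = 0 term is the integrand of α. Every other term has modulus equal to that integrand times
e^{-π²n²/s}, a factor independent of ξ and k; this is what makes the limit uniform. -/
theorem norm_beta_sub_alpha_le {s : ℝ} (hs : 0 < s) (k : ℤ) :
    ‖beta k s - (alpha (s * (k : ℝ) ^ 2) : ℂ)‖ ≤ alpha (s * (k : ℝ) ^ 2) *
      ∑' n : ℤ, if n = 0 then 0 else Real.exp (-(1 / s * Real.pi ^ 2 * (n : ℝ) ^ 2)) := by
  set δ := ∑' n : ℤ, if n = 0 then 0 else Real.exp (-(1 / s * Real.pi ^ 2 * (n : ℝ) ^ 2)) with hδ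
  have hδs : Summable fun n : ℤ =>
      if n = 0 then 0 else Real.exp (-(1 / s * Real.pi ^ 2 * (n : ℝ) ^ 2)) := by
    refine Summable.of_nonneg_of_le (fun n => by split_ifs <;> positivity) (fun n => ?_)
      (summable_theta hs)
    split_ifs
    · positivity
    · exact le_rfl
  rw [beta, alpha, ← intervalIntegral.integral_ofReal, ← intervalIntegral.integral_sub
    (intervalIntegrable_tsum_betaTerm hs k) (Continuous.intervalIntegrable (by fun_prop) _ _),
    ← intervalIntegral.integral_mul_const]
  refine intervalIntegral.norm_integral_le_of_norm_le zero_le_one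
    (Eventually.of_forall fun ξ hξ => ?_) (Continuous.intervalIntegrable (by fun_prop) _ _)
  have h0 : betaTerm k s ξ 0 = (Real.exp (-((1 - ξ ^ 2) / 4 * (s * (k : ℝ) ^ 2))) : ℂ) := by
    rw [betaTerm]
    push_cast
    ring_nf
  rw [(summable_betaTerm hs (Set.Ioc_subset_Icc_self hξ) k).tsum_eq_add_tsum_ite 0, h0]
  push_cast
  rw [add_sub_cancel_left]
  refine tsum_of_norm_bounded (hδs.hasSum.mul_left _) fun n => ?_
  split_ifs
  · simp
  · exact (norm_betaTerm k s ξ n).le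

theorem tendsto_tsum_ne_zero_exp {t : ℝ} (ht : 0 < t) : Tendsto (fun a : ℝ => ∑' n : ℤ,
    if n = 0 then 0 else Real.exp (-(1 / (t / a ^ 2) * Real.pi ^ 2 * (n : ℝ) ^ 2)))
    atTop (𝓝 0) := by
  have h := tendsto_tsum_of_dominated_convergence (𝓕 := atTop) (β := ℤ) (g := fun _ => (0 : ℝ))
    (f := fun (a : ℝ) (n : ℤ) =>
      if n = 0 then 0 else Real.exp (-(1 / (t / a ^ 2) * Real.pi ^ 2 * (n : ℝ) ^ 2)))
    (summable_theta ht) ?_ ?_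
  · simpa using h
  · intro n
    split_ifs with hn
    · exact tendsto_const_nhds
    · refine Real.tendsto_exp_atBot.comp (tendsto_neg_atTop_atBot.comp ?_)
      have hc : 0 < Real.pi ^ 2 * (n : ℝ) ^ 2 / t := by
        have : (n : ℝ) ≠ 0 := by exact_mod_cast hn
        positivity
      refine ((tendsto_pow_atTop two_ne_zero).const_mul_atTop hc).congr fun a => ?_
      rw [one_div_div]
      ring
  -- For a ≥ 1 the terms are dominated by those at a = 1.
  · filter_upwards [eventually_ge_atTop 1] with a ha n
    split_ifs
    · simpa using (Real.exp_pos _).le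
    · rw [Real.norm_of_nonneg (Real.exp_pos _).le, Real.exp_le_exp, neg_le_neg_iff, one_div_div]
      gcongr
      nlinarith

theorem norm_beta_div_alpha_sub_one_le {s : ℝ} (hs : 0 < s) (k : ℤ) :
    ‖beta k s / (alpha (s * (k : ℝ) ^ 2) : ℂ) - 1‖ ≤
      ∑' n : ℤ, if n = 0 then 0 else Real.exp (-(1 / s * Real.pi ^ 2 * (n : ℝ) ^ 2)) := by
  have hα := alpha_pos (s * (k : ℝ) ^ 2)
  have hα' : (alpha (s * (k : ℝ) ^ 2) : ℂ) ≠ 0 := by exact_mod_cast hα.ne'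
  rw [div_sub_one hα', norm_div, Complex.norm_real, Real.norm_of_nonneg hα.le, div_le_iff₀ hα]
  exact (norm_beta_sub_alpha_le hs k).trans (mul_comm _ _).le

theorem tendstoUniformly_beta_div_alpha {t : ℝ} (ht : 0 < t) : TendstoUniformly
    (fun (a : ℝ) (k : ℤ) => beta k (t / a ^ 2) / (alpha (t / a ^ 2 * (k : ℝ) ^ 2) : ℂ))
    (fun _ => 1) atTop := by
  rw [Metric.tendstoUniformly_iff]
  intro ε hε
  filter_upwards [(tendsto_tsum_ne_zero_exp ht).eventually_lt_const hε, eventually_gt_atTop 0]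
    with a ha ha0 k
  rw [dist_comm, dist_eq_norm]
  exact (norm_beta_div_alpha_sub_one_le (by positivity) k).trans_lt ha

end ThetaBeta

end CircleHeat

namespace CircleHeat

/-! ### Scalar Fourier series on the circle of radius a. -/

section FourierCoefficients

/-- The scalar Fourier coefficient on the circle of radius `a`. -/
noncomputable def scalarCoef (a : ℝ) (f : ℝ → ℂ) (k : ℤ) : ℂ :=
  (1 / (2 * Real.pi * a) : ℂ) *
    ∫ x in (0 : ℝ)..(2 * Real.pi * a), cexp (-(I * k * x / a)) * f x

theorem fourierCoef_apply {N : ℕ} (a : ℝ) (Q : ℝ → Matrix (Fin N) (Fin N) ℂ) (k : ℤ)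
    (i j : Fin N) : fourierCoef a Q k i j = scalarCoef a (fun x => Q x i j) k := rfl

/-- The Fourier mode `e^{ikx/a}`. -/
noncomputable def mode (a : ℝ) (k : ℤ) (x : ℝ) : ℂ := cexp (I * k * x / a)

variable {a : ℝ}

theorem norm_mode (a : ℝ) (k : ℤ) (x : ℝ) : ‖mode a k x‖ = 1 := by
  rw [mode, show I * k * x / a = ((k * x / a : ℝ) : ℂ) * I by push_cast; ring,
    Complex.norm_exp_ofReal_mul_I]

theorem norm_mode_neg (a : ℝ) (k : ℤ) (x : ℝ) : ‖cexp (-(I * k * x / a))‖ = 1 := by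
  rw [show -(I * k * x / a) = ((-(k * x / a) : ℝ) : ℂ) * I by push_cast; ring,
    Complex.norm_exp_ofReal_mul_I]

theorem continuous_mode (a : ℝ) (k : ℤ) : Continuous (mode a k) := by
  unfold mode
  fun_prop

theorem hasDerivAt_mode (a : ℝ) (k : ℤ) (x : ℝ) :
    HasDerivAt (mode a k) (I * k / a * mode a k x) x := by
  have h : HasDerivAt (fun y : ℝ => I * k * (y : ℂ) / a) (I * k / a) x := by
    have := ((Complex.ofRealCLM.hasDerivAt (x := x)).const_mul (I * k : ℂ)).div_const (a : ℂ)
    simpa using this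
  exact h.cexp.congr_deriv (by rw [mode]; ring)

theorem mode_periodic (ha : a ≠ 0) (k : ℤ) : Function.Periodic (mode a k) (2 * Real.pi * a) := by
  intro x
  have ha' : (a : ℂ) ≠ 0 := by exact_mod_cast ha
  rw [mode, mode, show I * k * ((x + 2 * Real.pi * a : ℝ) : ℂ) / a =
    I * k * x / a + k * (2 * Real.pi * I) by push_cast; field_simp,
    Complex.exp_add, Complex.exp_int_mul_two_pi_mul_I, mul_one]

theorem hasSum_scalarCoef (ha : 0 < a) {f : ℝ → ℂ} (hf : Continuous f)
    (hp : Function.Periodic f (2 * Real.pi * a)) (hs : Summable (scalarCoef a f)) (x : ℝ) :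
    HasSum (fun k => scalarCoef a f k * mode a k x) (f x) := by
  have hT : 0 < 2 * Real.pi * a := by positivity
  have : Fact (0 < 2 * Real.pi * a) := ⟨hT⟩
  have ha' : (a : ℂ) ≠ 0 := by exact_mod_cast ha.ne'
  have hπ : (Real.pi : ℂ) ≠ 0 := by exact_mod_cast Real.pi_ne_zero
  let g : C(AddCircle (2 * Real.pi * a), ℂ) :=
    ⟨hp.lift, continuous_coinduced_dom.2 hf⟩
  have hg : ∀ y : ℝ, g (y : AddCircle (2 * Real.pi * a)) = f y := fun y => hp.lift_coe y
  have hmode : ∀ (k : ℤ) (y : ℝ), fourier k (y : AddCircle (2 * Real.pi * a)) = mode a k y := by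
    intro k y
    rw [fourier_coe_apply, mode]
    congr 1
    push_cast
    field_simp
  have hcoef : ∀ k, fourierCoeff g k = scalarCoef a f k := by
    intro k
    rw [fourierCoeff_eq_intervalIntegral _ _ 0, scalarCoef, zero_add, Complex.real_smul]
    congr 1
    · push_cast
      rfl
    · refine intervalIntegral.integral_congr fun y _ => ?_
      change fourier (-k) (y : AddCircle (2 * Real.pi * a)) • g y = _
      rw [hmode, hg, mode, smul_eq_mul]
      congr 2
      push_cast
      ring
  have h := has_pointwise_sum_fourier_series_of_summable (f := g)
    (by simpa only [funext hcoef] using hs) x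
  simpa only [hcoef, hmode, hg, smul_eq_mul] using h

theorem intervalIntegrable_mode_mul {f : ℝ → ℂ} (hf : Continuous f) (k : ℤ) (c d : ℝ) :
    IntervalIntegrable (fun x : ℝ => cexp (-(I * k * x / a)) * f x) MeasureTheory.volume c d :=
  Continuous.intervalIntegrable (by fun_prop) _ _

theorem scalarCoef_add {f g : ℝ → ℂ} (hf : Continuous f) (hg : Continuous g) (k : ℤ) :
    scalarCoef a (fun x => f x + g x) k = scalarCoef a f k + scalarCoef a g k := by
  simp only [scalarCoef, mul_add]
  rw [intervalIntegral.integral_add (intervalIntegrable_mode_mul hf k _ _)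
    (intervalIntegrable_mode_mul hg k _ _), mul_add]

theorem scalarCoef_const_mul (c : ℂ) (f : ℝ → ℂ) (k : ℤ) :
    scalarCoef a (fun x => c * f x) k = c * scalarCoef a f k := by
  simp only [scalarCoef, mul_left_comm _ c]
  rw [intervalIntegral.integral_const_mul]
  ring

theorem scalarCoef_sum {ι : Type*} (s : Finset ι) {f : ι → ℝ → ℂ} (hf : ∀ i, Continuous (f i))
    (k : ℤ) : scalarCoef a (fun x => ∑ i ∈ s, f i x) k = ∑ i ∈ s, scalarCoef a (f i) k := by
  simp only [scalarCoef, Finset.mul_sum]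
  rw [intervalIntegral.integral_finsetSum fun i _ => intervalIntegrable_mode_mul (hf i) k _ _,
    Finset.mul_sum]

/-- Integration by parts; periodicity cancels the boundary terms. -/
theorem scalarCoef_deriv (ha : a ≠ 0) {f f' : ℝ → ℂ} (hf : ∀ x, HasDerivAt f (f' x) x)
    (hf' : Continuous f') (hp : Function.Periodic f (2 * Real.pi * a)) (k : ℤ) :
    scalarCoef a f' k = I * k / a * scalarCoef a f k := by
  have hd : ∀ x : ℝ, HasDerivAt (fun x : ℝ => cexp (-(I * k * x / a)))
      (-(I * k / a) * cexp (-(I * k * x / a))) x := by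
    intro x
    have h := hasDerivAt_mode a (-k) x
    have he : mode a (-k) = fun x : ℝ => cexp (-(I * k * x / a)) := by
      funext y
      rw [mode]
      congr 1
      push_cast
      ring
    rw [he] at h
    exact h.congr_deriv (by push_cast; ring)
  have h := intervalIntegral.integral_mul_deriv_eq_deriv_mul (a := 0) (b := 2 * Real.pi * a)
    (u := fun x : ℝ => cexp (-(I * k * x / a))) (v := f) (fun x _ => hd x) (fun x _ => hf x)
    (Continuous.intervalIntegrable (by fun_prop) _ _) (hf'.intervalIntegrable _ _)
  have h0 : f (2 * Real.pi * a) = f 0 := by simpa using hp 0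
  have h1 : cexp (-(I * k * ((2 * Real.pi * a : ℝ) : ℂ) / a)) = 1 := by
    have h2 := mode_periodic ha (-k) 0
    rw [mode, mode] at h2
    have e1 : -(I * k * ((2 * Real.pi * a : ℝ) : ℂ) / a) =
      I * ((-k : ℤ) : ℂ) * ((0 + 2 * Real.pi * a : ℝ) : ℂ) / a := by push_cast; ring
    rw [e1, h2]
    simp
  rw [scalarCoef, scalarCoef, h, h0, h1]
  simp only [mul_assoc, intervalIntegral.integral_const_mul]
  simp
  ring

theorem exists_norm_scalarCoef_le (ha : 0 < a) (f : ℝ → ℂ) :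
    ∃ C, 0 ≤ C ∧ ∀ k, ‖scalarCoef a f k‖ ≤ C := by
  refine ⟨‖(1 / (2 * Real.pi * a) : ℂ)‖ * ∫ x in (0 : ℝ)..(2 * Real.pi * a), ‖f x‖, ?_, ?_⟩
  · exact mul_nonneg (norm_nonneg _) (intervalIntegral.integral_nonneg (by positivity)
      fun x _ => norm_nonneg _)
  · intro k
    rw [scalarCoef, norm_mul]
    gcongr
    refine (intervalIntegral.norm_integral_le_integral_norm (by positivity)).trans (le_of_eq ?_)
    refine intervalIntegral.integral_congr fun x _ => ?_
    simp only [norm_mul, norm_mode_neg, one_mul]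

theorem summable_one_div_one_add_mul_int_sq {s : ℝ} (hs : 0 < s) :
    Summable fun n : ℤ => 1 / (1 + s * (n : ℝ) ^ 2) := by
  have h1 : Summable fun n : ℤ => 1 / s * (1 / (n : ℝ) ^ 2) + if n = 0 then 1 else 0 :=
    ((Real.summable_one_div_int_pow.2 one_lt_two).mul_left _).add (hasSum_ite_eq 0 1).summable
  refine Summable.of_nonneg_of_le (fun n => by positivity) (fun n => ?_) h1
  split_ifs with hn
  · simp [hn]
  · have hn' : (0 : ℝ) < (n : ℝ) ^ 2 := by
      have : (n : ℝ) ≠ 0 := by exact_mod_cast hn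
      positivity
    rw [add_zero, one_div_mul_one_div]
    gcongr
    linarith

/-- Two derivatives multiply the coefficient by -k²/a² and leave it bounded, so it decays like 1/(1
+ k²/a²). -/
theorem summable_norm_scalarCoef (ha : 0 < a) {f : ℝ → ℂ} (hf : ContDiff ℝ ∞ f)
    (hp : Function.Periodic f (2 * Real.pi * a)) : Summable fun k => ‖scalarCoef a f k‖ := by
  have hf1 : ContDiff ℝ ∞ (deriv f) := (contDiff_infty_iff_deriv.1 hf).2
  have hf2 : ContDiff ℝ ∞ (deriv (deriv f)) := (contDiff_infty_iff_deriv.1 hf1).2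
  have hp1 : Function.Periodic (deriv f) (2 * Real.pi * a) := by
    intro x
    rw [← deriv_comp_add_const]
    congr 1
    funext y
    exact hp y
  obtain ⟨C, hC0, hC⟩ := exists_norm_scalarCoef_le ha f
  obtain ⟨C', hC0', hC'⟩ := exists_norm_scalarCoef_le ha (deriv (deriv f))
  refine Summable.of_nonneg_of_le (fun k => norm_nonneg _) (fun k => ?_)
    ((summable_one_div_one_add_mul_int_sq (s := 1 / a ^ 2) (by positivity)).mul_left (C + C'))
  rw [mul_one_div, le_div_iff₀ (by positivity)]
  have h := hC' k
  rw [scalarCoef_deriv ha.ne' (fun x => (hf1.differentiable (by simp) x).hasDerivAt)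
    hf2.continuous hp1, scalarCoef_deriv ha.ne'
    (fun x => (hf.differentiable (by simp) x).hasDerivAt) hf1.continuous hp, ← mul_assoc,
    norm_mul] at h
  have h2 : ‖I * (k : ℂ) / a * (I * k / a)‖ = 1 / a ^ 2 * (k : ℝ) ^ 2 := by
    simp only [norm_mul, norm_div, Complex.norm_I, Complex.norm_intCast, Complex.norm_real,
      Real.norm_eq_abs]
    rw [one_mul, div_mul_div_comm, abs_mul_abs_self, abs_mul_abs_self]
    ring
  rw [h2] at h
  linarith [hC k]

theorem scalarCoef_one (ha : 0 < a) (k : ℤ) :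
    scalarCoef a (fun _ => 1) k = if k = 0 then 1 else 0 := by
  have ha' : (a : ℂ) ≠ 0 := by exact_mod_cast ha.ne'
  have hπ : (Real.pi : ℂ) ≠ 0 := by exact_mod_cast Real.pi_ne_zero
  split_ifs with hk
  · rw [scalarCoef, hk]
    simp
    field_simp
  · have h := scalarCoef_deriv (a := a) ha.ne' (f := fun _ => 1) (f' := fun _ => 0)
      (fun x => hasDerivAt_const x 1) continuous_const (fun _ => rfl) k
    have h0 : scalarCoef a (fun _ => 0) k = 0 := by simp [scalarCoef]
    rw [h0] at h
    refine (mul_eq_zero.1 h.symm).resolve_left ?_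
    have hk' : (k : ℂ) ≠ 0 := by exact_mod_cast hk
    exact div_ne_zero (mul_ne_zero Complex.I_ne_zero hk') ha'

/-- The Fourier coefficients of a product are the convolution of the Fourier coefficients. -/
theorem hasSum_scalarCoef_mul (a : ℝ) {q : ℤ → ℂ} (hq : Summable fun k => ‖q k‖) {v f : ℝ → ℂ}
    (hv : ∀ x, HasSum (fun k => q k * mode a k x) (v x)) (hf : Continuous f) (m : ℤ) :
    HasSum (fun k => q k * scalarCoef a f (m - k)) (scalarCoef a (fun x => v x * f x) m) := by
  obtain ⟨C, hC⟩ := (isCompact_uIcc (a := (0 : ℝ)) (b := 2 * Real.pi * a)).exists_bound_of_continuousOn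
    hf.continuousOn
  have hcm := continuous_mode a
  have h := hasSum_intervalIntegral_of_norm_le (a := 0) (b := 2 * Real.pi * a)
    (f := fun k x => cexp (-(I * m * x / a)) * (q k * mode a k x * f x))
    (u := fun k => ‖q k‖ * C)
    (fun k => by have := hcm k; fun_prop)
    (hq.mul_right C) (fun k x hx => by
      rw [norm_mul, norm_mul, norm_mul, norm_mode_neg, norm_mode, one_mul, mul_one]
      exact mul_le_mul_of_nonneg_left (hC x hx) (norm_nonneg _))
  have h2 : ∀ x : ℝ, ∑' k, cexp (-(I * m * x / a)) * (q k * mode a k x * f x) =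
      cexp (-(I * m * x / a)) * (v x * f x) := fun x =>
    (((hv x).mul_right (f x)).mul_left _).tsum_eq
  simp only [h2] at h
  have h3 := h.mul_left (1 / (2 * Real.pi * a) : ℂ)
  suffices hk : ∀ k, q k * scalarCoef a f (m - k) = (1 / (2 * Real.pi * a) : ℂ) *
      ∫ x in (0 : ℝ)..(2 * Real.pi * a), cexp (-(I * m * x / a)) * (q k * mode a k x * f x) by
    simp only [hk]
    exact h3
  intro k
  rw [scalarCoef, mul_left_comm, ← intervalIntegral.integral_const_mul]
  congr 1
  refine intervalIntegral.integral_congr fun x _ => ?_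
  have he : cexp (-(I * ((m - k : ℤ) : ℂ) * x / a)) = cexp (-(I * m * x / a)) * mode a k x := by
    rw [mode, ← Complex.exp_add]
    congr 1
    push_cast
    ring
  change q k * (cexp (-(I * ((m - k : ℤ) : ℂ) * x / a)) * f x) = _
  rw [he]
  ring

theorem scalarCoef_of_hasSum (ha : 0 < a) {q : ℤ → ℂ} (hq : Summable fun k => ‖q k‖) {v : ℝ → ℂ}
    (hv : ∀ x, HasSum (fun k => q k * mode a k x) (v x)) (m : ℤ) : scalarCoef a v m = q m := by
  have h := hasSum_scalarCoef_mul a hq hv (f := fun _ => 1) continuous_const m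
  simp only [scalarCoef_one ha, mul_one] at h
  refine h.unique ?_
  have h2 := hasSum_ite_eq m (q m)
  convert h2 using 1
  funext k
  by_cases hk : k = m
  · simp [hk]
  · have : m - k ≠ 0 := fun h => hk (sub_eq_zero.1 h).symm
    simp [hk, this]

/-- Vanishing coefficients are summable, so f is the sum of its Fourier series, which is zero. -/
theorem eq_zero_of_scalarCoef_eq_zero (ha : 0 < a) {f : ℝ → ℂ} (hf : Continuous f)
    (hp : Function.Periodic f (2 * Real.pi * a)) (h : ∀ k, scalarCoef a f k = 0) (x : ℝ) :
    f x = 0 := by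
  have hs : Summable (scalarCoef a f) := by
    rw [funext h]
    exact summable_zero
  have := hasSum_scalarCoef ha hf hp hs x
  simp only [h, zero_mul] at this
  exact this.unique hasSum_zero

theorem hasSum_mode_of_summable {q : ℤ → ℂ} (hq : Summable fun k => ‖q k‖) (a x : ℝ) :
    HasSum (fun k => q k * mode a k x) (∑' k, q k * mode a k x) :=
  (Summable.of_norm_bounded hq fun k => by rw [norm_mul, norm_mode, mul_one]).hasSum

theorem continuous_tsum_mode {q : ℤ → ℂ} (hq : Summable fun k => ‖q k‖) (a : ℝ) :
    Continuous fun x => ∑' k, q k * mode a k x :=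
  continuous_tsum (fun k => continuous_const.mul (continuous_mode a k)) hq
    fun k x => by rw [norm_mul, norm_mode, mul_one]

theorem periodic_tsum_mode (ha : a ≠ 0) (q : ℤ → ℂ) :
    Function.Periodic (fun x => ∑' k, q k * mode a k x) (2 * Real.pi * a) :=
  fun x => tsum_congr fun k => by rw [mode_periodic ha k x]

theorem hasDerivAt_tsum_mode {q : ℤ → ℂ} (hq : Summable fun k => ‖q k‖)
    (hq' : Summable fun k => ‖I * k / a * q k‖) (x : ℝ) :
    HasDerivAt (fun x => ∑' k, q k * mode a k x) (∑' k, (I * k / a * q k) * mode a k x) x := by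
  refine hasDerivAt_tsum (g' := fun k x => (I * k / a * q k) * mode a k x) hq' (fun k y => ((hasDerivAt_mode a k y).const_mul (q k)).congr_deriv
    (by ring)) (fun k y => by rw [norm_mul, norm_mode, mul_one])
    (hasSum_mode_of_summable hq a 0).summable x

end FourierCoefficients

end CircleHeat

namespace CircleHeat

/-! ### Multiplication by Q as a bounded convolution operator on ℓ². -/

section Convolution

variable {ι E : Type*} [NormedAddCommGroup E] [InnerProductSpace ℂ E]

/-- Building block of the convolution: a shift of modes times a matrix unit permutes the coordinates
and erases some of them, hence is a contraction. -/
theorem exists_partial_permutation (b : HilbertBasis ι ℂ E) (σ : Equiv.Perm ι) (s : Set ι)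
    [DecidablePred (· ∈ s)] : ∃ T : E →L[ℂ] E,
    (∀ u p, inner ℂ (b p) (T u) = if p ∈ s then inner ℂ (b (σ p)) u else 0) ∧ ‖T‖ ≤ 1 := by
  have hperm : ∀ u : E, HasSum (fun p => ‖inner ℂ (b (σ p)) u‖ ^ 2) (‖u‖ ^ 2) := fun u =>
    σ.hasSum_iff.2 (hasSum_norm_inner_sq b u)
  have hle : ∀ (u : E) p, ‖(if p ∈ s then inner ℂ (b (σ p)) u else 0 : ℂ)‖ ^ 2 ≤
      ‖inner ℂ (b (σ p)) u‖ ^ 2 := by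
    intro u p
    split_ifs
    · exact le_rfl
    · simp
  have hex : ∀ u : E, ∃ y : E, ∀ p, inner ℂ (b p) y =
      if p ∈ s then inner ℂ (b (σ p)) u else 0 := fun u =>
    exists_inner_eq b _ (Summable.of_nonneg_of_le (fun p => by positivity) (hle u)
      (hperm u).summable)
  choose F hF using hex
  have hn : ∀ u, ‖F u‖ ≤ 1 * ‖u‖ := by
    intro u
    rw [one_mul]
    refine le_of_sq_le_sq ?_ (norm_nonneg _)
    refine hasSum_le (fun p => ?_) (hasSum_norm_inner_sq b (F u)) (hperm u)
    rw [hF]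
    exact hle u p
  refine ⟨LinearMap.mkContinuous
    { toFun := F
      map_add' := fun x y => ext_inner b fun i => by
        simp only [hF, inner_add_right]
        split_ifs <;> simp
      map_smul' := fun c x => ext_inner b fun i => by
        simp only [hF, inner_smul_right, RingHom.id_apply]
        split_ifs <;> simp } 1 hn, fun x i => hF x i, LinearMap.mkContinuous_norm_le _ zero_le_one _⟩

theorem symm_of_matrix_symm [CompleteSpace E] (b : HilbertBasis ι ℂ E) {W : E →L[ℂ] E}
    (h : ∀ p r, inner ℂ (b p) (W (b r)) = starRingEnd ℂ (inner ℂ (b r) (W (b p)))) (x y : E) :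
    inner ℂ (W x) y = inner ℂ x (W y) := by
  have hadj : ContinuousLinearMap.adjoint W = W := by
    refine ContinuousLinearMap.ext_on (s := Set.range b) ?_ ?_
    · exact Submodule.dense_iff_topologicalClosure_eq_top.2 b.dense_span
    · rintro _ ⟨r, rfl⟩
      refine ext_inner b fun p => ?_
      rw [ContinuousLinearMap.adjoint_inner_right, h p r, inner_conj_symm]
  conv_rhs => rw [← hadj]
  rw [ContinuousLinearMap.adjoint_inner_right]

variable {N : ℕ}

/-- Convolution with a summable sequence of matrices acts boundedly. -/
theorem exists_convolution [CompleteSpace E] (b : HilbertBasis (ℤ × Fin N) ℂ E)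
    (q : ℤ → Matrix (Fin N) (Fin N) ℂ) (hq : ∀ i j, Summable fun k => ‖q k i j‖) :
    ∃ T : E →L[ℂ] E, (∀ u m i, HasSum (fun k => ∑ j, q k i j * inner ℂ (b (m - k, j)) u)
      (inner ℂ (b (m, i)) (T u))) ∧ ‖T‖ ≤ ∑' k, ∑ i, ∑ j, ‖q k i j‖ := by
  have hS : ∀ (k : ℤ) (i j : Fin N), ∃ S : E →L[ℂ] E,
      (∀ u m i', inner ℂ (b (m, i')) (S u) = if i' = i then inner ℂ (b (m - k, j)) u else 0) ∧
      ‖S‖ ≤ 1 := by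
    intro k i j
    -- Only row i is kept, and there the swap sends i to j; elsewhere it serves to make the index
    -- map a bijection.
    obtain ⟨S, hS, hn⟩ := exists_partial_permutation b
      (Equiv.prodCongr (Equiv.subRight k) (Equiv.swap i j)) {p | p.2 = i}
    refine ⟨S, fun u m i' => ?_, hn⟩
    rw [hS]
    simp only [Set.mem_ofPred_eq]
    split_ifs with h
    · subst h
      simp
    · rfl
  choose S hS hSn using hS
  have hsum : Summable fun k => ∑ i, ∑ j, ‖q k i j‖ :=
    summable_sum fun i _ => summable_sum fun j _ => hq i j
  have hle : ∀ k, ‖∑ i, ∑ j, q k i j • S k i j‖ ≤ ∑ i, ∑ j, ‖q k i j‖ := by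
    intro k
    refine norm_sum_le_of_le _ fun i _ => norm_sum_le_of_le _ fun j _ => ?_
    rw [norm_smul]
    exact mul_le_of_le_one_right (norm_nonneg _) (hSn k i j)
  have hT := (Summable.of_norm_bounded hsum hle).hasSum
  refine ⟨∑' k, ∑ i, ∑ j, q k i j • S k i j, fun u m i => ?_,
    tsum_of_norm_bounded hsum.hasSum hle⟩
  have h := ((innerSL ℂ (b (m, i))).comp
    (ContinuousLinearMap.apply ℂ E u : (E →L[ℂ] E) →L[ℂ] E)).hasSum hT
  suffices hk : ∀ k, ∑ j, q k i j * inner ℂ (b (m - k, j)) u =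
      inner ℂ (b (m, i)) ((∑ i, ∑ j, q k i j • S k i j) u) by
    simp only [hk]
    exact h
  intro k
  simp only [sum_apply, smul_apply, inner_sum, inner_smul_right, hS, mul_ite, mul_zero]
  rw [Finset.sum_comm]
  simp [Finset.sum_ite_eq]

variable {b : HilbertBasis (ℤ × Fin N) ℂ E} {q : ℤ → Matrix (Fin N) (Fin N) ℂ} {T : E →L[ℂ] E}

theorem inner_convolution_basis
    (hT : ∀ u m i, HasSum (fun k => ∑ j, q k i j * inner ℂ (b (m - k, j)) u)
      (inner ℂ (b (m, i)) (T u))) (p r : ℤ × Fin N) :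
    inner ℂ (b p) (T (b r)) = q (p.1 - r.1) p.2 r.2 := by
  refine (hT (b r) p.1 p.2).unique ?_
  convert hasSum_ite_eq (p.1 - r.1) (q (p.1 - r.1) p.2 r.2) using 1
  funext k
  simp only [orthonormal_iff_ite.1 b.orthonormal, Prod.ext_iff, ite_and, mul_ite, mul_one, mul_zero]
  by_cases hk : k = p.1 - r.1
  · subst hk
    simp
  · have : p.1 - k ≠ r.1 := fun h => hk (by linarith)
    simp [hk, this]

theorem convolution_symm [CompleteSpace E]
    (hT : ∀ u m i, HasSum (fun k => ∑ j, q k i j * inner ℂ (b (m - k, j)) u)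
      (inner ℂ (b (m, i)) (T u))) (hq : ∀ k, q (-k) = (q k)ᴴ) (x y : E) :
    inner ℂ (T x) y = inner ℂ x (T y) := by
  refine symm_of_matrix_symm b (fun p r => ?_) x y
  rw [inner_convolution_basis hT, inner_convolution_basis hT, ← neg_sub, hq,
    Matrix.conjTranspose_apply]
  rfl

theorem summable_prod_fin {α : Type*} {f : α × Fin N → ℝ} (h0 : ∀ p, 0 ≤ f p)
    (h : ∀ i, Summable fun m => f (m, i)) : Summable f := by
  rw [← (Equiv.prodComm (Fin N) α).summable_iff]
  exact (summable_prod_of_nonneg fun _ => h0 _).2 ⟨h, (hasSum_fintype _).summable⟩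

theorem summable_column (hq : ∀ i j, Summable fun k => ‖q k i j‖) (r : ℤ × Fin N) :
    Summable fun p : ℤ × Fin N => ‖q (p.1 - r.1) p.2 r.2‖ :=
  summable_prod_fin (fun _ => norm_nonneg _) fun i =>
    (Equiv.subRight r.1).summable_iff.2 (hq i r.2)

/-- Supplies the ℓ¹ bound on the columns of the perturbation that the trace expansion needs, with
the same constant as the bound on the operator norm. -/
theorem tsum_column_le (hq : ∀ i j, Summable fun k => ‖q k i j‖) (r : ℤ × Fin N) :
    ∑' p : ℤ × Fin N, ‖q (p.1 - r.1) p.2 r.2‖ ≤ ∑' k, ∑ i, ∑ j, ‖q k i j‖ := by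
  have h1 : Summable fun k => ∑ i, ‖q k i r.2‖ := summable_sum fun i _ => hq i r.2
  rw [(summable_column hq r).tsum_prod' fun m => (hasSum_fintype _).summable]
  simp only [tsum_fintype]
  refine ((Equiv.subRight r.1).tsum_eq fun k => ∑ i, ‖q k i r.2‖).trans_le ?_
  refine h1.tsum_le_tsum (fun k => Finset.sum_le_sum fun i _ => ?_)
    (summable_sum fun i _ => summable_sum fun j _ => hq i j)
  exact Finset.single_le_sum (f := fun j => ‖q k i j‖) (fun j _ => norm_nonneg _)
    (Finset.mem_univ r.2)

/-- Young's inequality ℓ¹ * ℓ¹ ⊂ ℓ¹, by the substitution (m, k) ↦ (k, m - k). -/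
theorem summable_convolution {u : ℤ × Fin N → ℂ}
    (hq : ∀ i j, Summable fun k => ‖q k i j‖) (hu : Summable fun p => ‖u p‖)
    {v : ℤ × Fin N → ℂ} (hv : ∀ m i, HasSum (fun k => ∑ j, q k i j * u (m - k, j)) (v (m, i))) :
    Summable fun p => ‖v p‖ := by
  let e : ℤ × ℤ ≃ ℤ × ℤ :=
    { toFun := fun p => (p.2, p.1 - p.2)
      invFun := fun p => (p.1 + p.2, p.1)
      left_inv := fun p => by simp
      right_inv := fun p => by simp }
  refine summable_prod_fin (fun _ => norm_nonneg _) fun i => ?_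
  have hprod : Summable fun p : ℤ × ℤ => ∑ j, ‖q p.2 i j‖ * ‖u (p.1 - p.2, j)‖ := by
    refine summable_sum fun j _ => ?_
    have hj : Summable fun m => ‖u (m, j)‖ :=
      hu.comp_injective (i := fun m => (m, j)) fun m m' h => (Prod.ext_iff.1 h).1
    exact e.summable_iff.2 ((hq i j).mul_of_nonneg hj (fun _ => norm_nonneg _)
      fun _ => norm_nonneg _)
  refine Summable.of_nonneg_of_le (fun m => norm_nonneg _) (fun m => ?_) hprod.prod
  rw [← (hv m i).tsum_eq]
  refine tsum_of_norm_bounded (hprod.prod_factor m).hasSum fun k => ?_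
  refine norm_sum_le_of_le _ fun j _ => ?_
  rw [norm_mul]

end Convolution

end CircleHeat

namespace CircleHeat

/-! ### Smooth eigenfunctions and ℓ² eigenvectors. -/

section Correspondence

variable {N : ℕ} {a : ℝ} {V : ℝ → Matrix (Fin N) (Fin N) ℂ}

theorem periodic_of_hasDerivAt {f f' : ℝ → ℂ} {c : ℝ} (hf : ∀ x, HasDerivAt f (f' x) x)
    (hp : Function.Periodic f c) : Function.Periodic f' c := by
  intro x
  have h := (hf (x + c)).comp_add_const x c
  rw [show (fun y => f (y + c)) = f from funext hp] at h
  exact h.unique (hf x)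

theorem summable_fourierCoef (ha : 0 < a) (hV : ∀ i j, ContDiff ℝ ∞ (fun x => V x i j))
    (hVp : Function.Periodic V (2 * Real.pi * a)) (i j : Fin N) :
    Summable fun k => ‖fourierCoef a V k i j‖ :=
  summable_norm_scalarCoef ha (hV i j) fun x => congrFun (congrFun (hVp x) i) j

theorem scalarCoef_laplace (ha : 0 < a) (hV : ∀ i j, ContDiff ℝ ∞ (fun x => V x i j))
    (hVp : Function.Periodic V (2 * Real.pi * a)) {f f' f'' : Fin N → ℝ → ℂ}
    (hf : ∀ j x, HasDerivAt (f j) (f' j x) x) (hf' : ∀ j x, HasDerivAt (f' j) (f'' j x) x)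
    (hc : ∀ j, Continuous (f'' j)) (hp : ∀ j, Function.Periodic (f j) (2 * Real.pi * a))
    {m : ℤ} {i : Fin N} {w : ℂ}
    (hw : HasSum (fun k => ∑ j, fourierCoef a V k i j * scalarCoef a (f j) (m - k)) w) :
    scalarCoef a (fun x => -f'' i x + ∑ j, V x i j * f j x) m =
      (((m : ℝ) ^ 2 / a ^ 2 : ℝ) : ℂ) * scalarCoef a (f i) m + w := by
  have hfc : ∀ j, Continuous (f j) := fun j =>
    continuous_iff_continuousAt.2 fun x => (hf j x).continuousAt
  have hfc' : ∀ j, Continuous (f' j) := fun j =>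
    continuous_iff_continuousAt.2 fun x => (hf' j x).continuousAt
  have hVc : ∀ i j, Continuous fun x => V x i j := fun i j => (hV i j).continuous
  have h1 : scalarCoef a (fun x => -f'' i x) m =
      (((m : ℝ) ^ 2 / a ^ 2 : ℝ) : ℂ) * scalarCoef a (f i) m := by
    have h := scalarCoef_const_mul (a := a) (-1) (f'' i) m
    simp only [neg_one_mul] at h
    rw [h, scalarCoef_deriv ha.ne' (hf' i) (hc i) (periodic_of_hasDerivAt (hf i) (hp i)),
      scalarCoef_deriv ha.ne' (hf i) (hfc' i) (hp i)]
    push_cast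
    linear_combination (-(m : ℂ) ^ 2 / a ^ 2 * scalarCoef a (f i) m) * Complex.I_mul_I
  have h2 : scalarCoef a (fun x => ∑ j, V x i j * f j x) m = w := by
    rw [scalarCoef_sum (f := fun j x => V x i j * f j x) _ fun j => (hVc i j).mul (hfc j)]
    refine HasSum.unique (hasSum_sum fun j _ => ?_) hw
    have hs := summable_fourierCoef ha hV hVp i j
    refine hasSum_scalarCoef_mul a hs (fun x => ?_) (hfc j) m
    exact hasSum_scalarCoef ha (hVc i j) (fun x => congrFun (congrFun (hVp x) i) j)
      hs.of_norm x
  rw [scalarCoef_add (f := fun x => -f'' i x) (g := fun x => ∑ j, V x i j * f j x) (hc i).neg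
    (continuous_finsetSum _ fun j _ => (hVc i j).mul (hfc j)), h1, h2]

theorem hasDerivAt_apply {f : ℝ → Fin N → ℂ} (hf : ContDiff ℝ ∞ f) (i : Fin N) (x : ℝ) :
    HasDerivAt (fun x => f x i) (deriv f x i) x :=
  hasDerivAt_pi.1 ((hf.differentiable (by simp) x).hasDerivAt) i

theorem contDiff_deriv {f : ℝ → Fin N → ℂ} (hf : ContDiff ℝ ∞ f) : ContDiff ℝ ∞ (deriv f) :=
  (contDiff_infty_iff_deriv.1 hf).2

theorem summable_coef_section (ha : 0 < a) {f : ℝ → Fin N → ℂ} (hf : f ∈ smoothSections a N) :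
    Summable fun p : ℤ × Fin N => ‖scalarCoef a (fun x => f x p.2) p.1‖ := by
  obtain ⟨hf1, hf2⟩ := hf
  refine summable_prod_fin (fun _ => norm_nonneg _) fun i => ?_
  have h1 : ContDiff ℝ ∞ fun x => f x i := contDiff_pi.1 hf1 i
  have h2 : Function.Periodic (fun x => f x i) (2 * Real.pi * a) := fun x => congrFun (hf2 x) i
  have h3 := summable_norm_scalarCoef ha h1 h2
  exact h3

/-- A `C²` solution of a linear second-order system with smooth coefficients is smooth. -/
theorem contDiff_of_hasDerivAt {f g h : ℝ → Fin N → ℂ} (hf : ∀ x, HasDerivAt f (g x) x)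
    (hg : ∀ x, HasDerivAt g (h x) x) {M : ℝ → Matrix (Fin N) (Fin N) ℂ}
    (hM : ∀ i j, ContDiff ℝ ∞ (fun x => M x i j)) (hh : ∀ x i, h x i = ∑ j, M x i j * f x j) :
    ContDiff ℝ ∞ f := by
  have hfd : deriv f = g := funext fun x => (hf x).deriv
  have hgd : deriv g = h := funext fun x => (hg x).deriv
  rw [contDiff_infty]
  intro n
  induction n with
  | zero =>
    exact contDiff_zero.2 (continuous_iff_continuousAt.2 fun x => (hf x).continuousAt)
  | succ n ih =>
    -- Bootstrap: the equation gives the second derivative h the regularity of f, and integrating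
    -- gains an order.
    have h1 : ContDiff ℝ n h := by
      refine contDiff_pi.2 fun i => ?_
      simp only [hh]
      exact ContDiff.sum fun j _ =>
        ((hM i j).of_le (by exact_mod_cast le_top)).mul (contDiff_pi.1 ih j)
    have h2 : ContDiff ℝ (n + 1 : ℕ) g := by
      push_cast
      exact contDiff_succ_iff_deriv.2 ⟨fun x => (hg x).differentiableAt, by simp, by rwa [hgd]⟩
    push_cast
    refine contDiff_succ_iff_deriv.2 ⟨fun x => (hf x).differentiableAt, by simp, ?_⟩
    rw [hfd]
    exact h2.of_le (by exact_mod_cast Nat.le_succ n)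

variable {E : Type*} [NormedAddCommGroup E] [InnerProductSpace ℂ E]
  {b : HilbertBasis (ℤ × Fin N) ℂ E} {T : E →L[ℂ] E} {lam : ℝ}

/-- The eigenvalues of `-∂²` on the circle of radius `a`, indexed by the Fourier basis. -/
noncomputable def freeEigenvalue (a : ℝ) (p : ℤ × Fin N) : ℝ := (p.1 : ℝ) ^ 2 / a ^ 2

theorem summable_one_div_freeEigenvalue (ha : 0 < a) {t : ℝ} (ht : 0 < t) :
    Summable fun p : ℤ × Fin N => 1 / (1 + t * freeEigenvalue a p) := by
  have h0 : ∀ p : ℤ × Fin N, 0 ≤ freeEigenvalue a p := fun p => by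
    unfold freeEigenvalue
    positivity
  refine summable_prod_fin (fun p => ?_) fun i => ?_
  · have := h0 p
    positivity
  · refine (summable_one_div_one_add_mul_int_sq (s := t / a ^ 2) (by positivity)).congr fun m => ?_
    rw [freeEigenvalue]
    ring_nf

/-- (1 + D)u = u + λu - Tu is in ℓ² and the diagonal of (1 + D)⁻¹ is summable, so u has ℓ¹
coefficients. -/
theorem summable_norm_inner_of_mem (ha : 0 < a) {u : E}
    (hu : u ∈ pertEigenspace b (freeEigenvalue a) T lam) :
    Summable fun p => ‖inner ℂ (b p) u‖ := by
  have h0 : ∀ p : ℤ × Fin N, 0 ≤ freeEigenvalue a p := fun p => by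
    unfold freeEigenvalue
    positivity
  set w : E := u + (lam : ℂ) • u - T u
  have hw : ∀ p, ‖inner ℂ (b p) w‖ = (1 + freeEigenvalue a p) * ‖inner ℂ (b p) u‖ := by
    intro p
    have h : inner ℂ (b p) w = ((1 + freeEigenvalue a p : ℝ) : ℂ) * inner ℂ (b p) u := by
      rw [inner_sub_right, inner_add_right, inner_smul_right]
      push_cast
      linear_combination -(mem_pertEigenspace.1 hu p)
    rw [h, norm_mul, Complex.norm_real, Real.norm_of_nonneg (by linarith [h0 p])]
  have hs := summable_one_div_freeEigenvalue (N := N) ha one_pos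
  refine Summable.of_nonneg_of_le (fun p => norm_nonneg _) (fun p => ?_)
    ((hasSum_norm_inner_sq b w).summable.add hs)
  have hd : 0 < 1 + freeEigenvalue a p := by linarith [h0 p]
  set c := ‖inner ℂ (b p) u‖ with hc
  set d := 1 + freeEigenvalue a p with hd'
  rw [hw p, one_mul, ← hd']
  have h1 : 1 ≤ d := by linarith [h0 p]
  have hc0 : 0 ≤ c := norm_nonneg _
  -- From 2dc ≤ (dc)² + 1 and d ≥ 1.
  have h2 : c ≤ ((d * c) ^ 2 * d + 1) / d := by
    rw [le_div_iff₀ hd]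
    nlinarith [sq_nonneg (d * c - 1), mul_nonneg (sub_nonneg.2 h1) (sq_nonneg (d * c)),
      mul_nonneg hd.le hc0]
  calc c ≤ ((d * c) ^ 2 * d + 1) / d := h2
    _ = (d * c) ^ 2 + 1 / d := by field_simp

/-- The coefficients of u are in ℓ¹, hence those of Tu, hence those of Du = λu - Tu. So the Fourier
series may be differentiated twice term by term, and the sum is a C² solution of the eigenvalue
equation, hence smooth. -/
theorem exists_section_of_mem [CompleteSpace E] (ha : 0 < a)
    (hV : ∀ i j, ContDiff ℝ ∞ (fun x => V x i j))
    (hVp : Function.Periodic V (2 * Real.pi * a))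
    (hT : ∀ u m i, HasSum (fun k => ∑ j, fourierCoef a V k i j * inner ℂ (b (m - k, j)) u)
      (inner ℂ (b (m, i)) (T u)))
    {u : E} (hu : u ∈ pertEigenspace b (freeEigenvalue a) T lam) :
    ∃ f ∈ eigenspace a V lam, ∀ m i, scalarCoef a (fun x => f x i) m = inner ℂ (b (m, i)) u := by
  have ha' : (a : ℂ) ≠ 0 := by exact_mod_cast ha.ne'
  have hs0 := summable_norm_inner_of_mem ha hu
  have hsT := summable_convolution (fun i j => summable_fourierCoef ha hV hVp i j) hs0
    (v := fun p => inner ℂ (b p) (T u)) (hT u)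
  have hs2 : Summable fun p : ℤ × Fin N => ‖(freeEigenvalue a p : ℂ) * inner ℂ (b p) u‖ := by
    refine Summable.of_nonneg_of_le (fun p => norm_nonneg _) (fun p => ?_)
      ((hs0.mul_left |lam|).add hsT)
    rw [eq_sub_of_add_eq (mem_pertEigenspace.1 hu p)]
    refine (norm_sub_le _ _).trans_eq ?_
    rw [norm_mul, Complex.norm_real, Real.norm_eq_abs]
  have hinj : ∀ i : Fin N, Function.Injective fun m : ℤ => (m, i) := fun i m m' h =>
    (Prod.ext_iff.1 h).1
  let c : Fin N → ℤ → ℂ := fun i m => inner ℂ (b (m, i)) u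
  have hc0 : ∀ i, Summable fun m => ‖c i m‖ := fun i => hs0.comp_injective (hinj i)
  have hc2 : ∀ i, Summable fun m : ℤ => ‖I * m / a * (I * m / a * c i m)‖ := fun i => by
    refine (hs2.comp_injective (hinj i)).congr fun m => ?_
    simp only [Function.comp_apply, freeEigenvalue, norm_mul, norm_div, Complex.norm_I,
      Complex.norm_intCast, Complex.norm_real, Real.norm_eq_abs, abs_pow, c]
    ring
  have hc1 : ∀ i, Summable fun m : ℤ => ‖I * m / a * c i m‖ := fun i => by
    refine Summable.of_nonneg_of_le (fun p => norm_nonneg _) (fun m => ?_) ((hc0 i).add (hc2 i))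
    simp only [norm_mul]
    set x := ‖I * (m : ℂ) / a‖
    -- First-order coefficients interpolate between orders zero and two: x ≤ 1 + x².
    nlinarith [norm_nonneg (c i m), mul_nonneg (sq_nonneg (x - 1)) (norm_nonneg (c i m)),
      mul_nonneg (sq_nonneg x) (norm_nonneg (c i m))]
  let F : Fin N → ℝ → ℂ := fun i x => ∑' m, c i m * mode a m x
  let F' : Fin N → ℝ → ℂ := fun i x => ∑' m : ℤ, (I * m / a * c i m) * mode a m x
  let F'' : Fin N → ℝ → ℂ := fun i x => ∑' m : ℤ, (I * m / a * (I * m / a * c i m)) * mode a m x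
  have hF : ∀ i x, HasDerivAt (F i) (F' i x) x := fun i x => hasDerivAt_tsum_mode (hc0 i) (hc1 i) x
  have hF' : ∀ i x, HasDerivAt (F' i) (F'' i x) x := fun i x =>
    hasDerivAt_tsum_mode (hc1 i) (hc2 i) x
  have hFc'' : ∀ i, Continuous (F'' i) := fun i => continuous_tsum_mode (hc2 i) a
  have hFc : ∀ i, Continuous (F i) := fun i => continuous_tsum_mode (hc0 i) a
  have hFp : ∀ i, Function.Periodic (F i) (2 * Real.pi * a) := fun i =>
    periodic_tsum_mode ha.ne' (c i)
  have hFp'' : ∀ i, Function.Periodic (F'' i) (2 * Real.pi * a) := fun i =>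
    periodic_tsum_mode ha.ne' _
  have hcoef : ∀ i m, scalarCoef a (F i) m = c i m := fun i m =>
    scalarCoef_of_hasSum ha (hc0 i) (hasSum_mode_of_summable (hc0 i) a) m
  have hVc : ∀ i j, Continuous fun x => V x i j := fun i j => (hV i j).continuous
  have hode : ∀ i x, -F'' i x + ∑ j, V x i j * F j x = lam * F i x := by
    intro i x
    have hcont : Continuous fun x => -F'' i x + ∑ j, V x i j * F j x :=
      (hFc'' i).neg.add (continuous_finsetSum _ fun j _ => (hVc i j).mul (hFc j))
    -- The residual of the equation is continuous and periodic, and its Fourier coefficients vanish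
    -- by the eigenvector equation in ℓ².
    have h := eq_zero_of_scalarCoef_eq_zero ha
      (f := fun x => (-F'' i x + ∑ j, V x i j * F j x) + -(lam : ℂ) * F i x)
      (hcont.add (continuous_const.mul (hFc i))) (fun x => by
        simp only [hFp _ x, hFp'' _ x, hVp x]) (fun m => ?_) x
    · linear_combination h
    · rw [scalarCoef_add (f := fun x => -F'' i x + ∑ j, V x i j * F j x)
        (g := fun x => -(lam : ℂ) * F i x) hcont (continuous_const.mul (hFc i)), scalarCoef_const_mul,
        scalarCoef_laplace ha hV hVp hF hF' hFc'' hFp (w := inner ℂ (b (m, i)) (T u))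
          (by simpa only [hcoef] using hT u m i), hcoef]
      have := mem_pertEigenspace.1 hu (m, i)
      simp only [freeEigenvalue] at this
      linear_combination this
  let f : ℝ → Fin N → ℂ := fun x i => F i x
  have hf1 : ∀ x, HasDerivAt f (fun i => F' i x) x := fun x => hasDerivAt_pi.2 fun i => hF i x
  have hf2 : ∀ x, HasDerivAt (fun x i => F' i x) (fun i => F'' i x) x := fun x =>
    hasDerivAt_pi.2 fun i => hF' i x
  have hsmooth : ContDiff ℝ ∞ f := by
    refine contDiff_of_hasDerivAt hf1 hf2 (M := fun x => V x - (lam : ℂ) • (1 : Matrix _ _ ℂ))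
      (fun i j => ?_) fun x i => ?_
    · simp only [Matrix.sub_apply]
      exact (hV i j).sub contDiff_const
    · simp only [Matrix.sub_apply, Matrix.smul_apply, Matrix.one_apply, sub_mul,
        Finset.sum_sub_distrib, smul_eq_mul, mul_ite, mul_one, mul_zero, ite_mul, zero_mul,
        Finset.sum_ite_eq, Finset.mem_univ, if_true]
      linear_combination -(hode i x)
  refine ⟨f, ⟨⟨hsmooth, fun x => funext fun i => hFp i x⟩, ?_⟩, fun m i => hcoef i m⟩
  funext x i
  have hd : deriv f = fun x i => F' i x := funext fun x => (hf1 x).deriv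
  rw [laplaceOp, hd, (hf2 x).deriv]
  exact hode i x

theorem mem_pertEigenspace_of_section [CompleteSpace E] (ha : 0 < a)
    (hV : ∀ i j, ContDiff ℝ ∞ (fun x => V x i j))
    (hVp : Function.Periodic V (2 * Real.pi * a))
    (hT : ∀ u m i, HasSum (fun k => ∑ j, fourierCoef a V k i j * inner ℂ (b (m - k, j)) u)
      (inner ℂ (b (m, i)) (T u)))
    {f : ℝ → Fin N → ℂ} (hf : f ∈ eigenspace a V lam) {u : E}
    (hu : ∀ m i, inner ℂ (b (m, i)) u = scalarCoef a (fun x => f x i) m) :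
    u ∈ pertEigenspace b (freeEigenvalue a) T lam := by
  rintro ⟨m, i⟩
  obtain ⟨⟨hfs, hfp⟩, hfe⟩ := hf
  have hw := hT u m i
  simp only [hu] at hw
  have hc2 := (contDiff_deriv (contDiff_deriv hfs)).continuous
  have h := scalarCoef_laplace ha hV hVp (f := fun j x => f x j) (f' := fun j x => deriv f x j)
    (f'' := fun j x => deriv (deriv f) x j) (fun j x => hasDerivAt_apply hfs j x)
    (fun j x => hasDerivAt_apply (contDiff_deriv hfs) j x)
    (fun j => (continuous_apply j).comp hc2) (fun j x => congrFun (hfp x) j) hw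
  have he : ∀ x, -deriv (deriv f) x i + ∑ j, V x i j * f x j = lam * f x i := fun x =>
    congrFun (congrFun hfe x) i
  simp only [he] at h
  rw [scalarCoef_const_mul] at h
  rw [hu, h]
  rfl

/-- Taking Fourier coefficients is linear, injective by uniqueness, and surjective by regularity of
eigenvectors. It transfers finiteness and multiplicities to Hilbert space. -/
theorem nonempty_eigenspace_equiv [CompleteSpace E] (ha : 0 < a)
    (hV : ∀ i j, ContDiff ℝ ∞ (fun x => V x i j))
    (hVp : Function.Periodic V (2 * Real.pi * a))
    (hT : ∀ u m i, HasSum (fun k => ∑ j, fourierCoef a V k i j * inner ℂ (b (m - k, j)) u)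
      (inner ℂ (b (m, i)) (T u))) (lam : ℝ) :
    Nonempty (eigenspace a V lam ≃ₗ[ℂ] pertEigenspace b (freeEigenvalue a) T lam) := by
  have hex : ∀ f : eigenspace a V lam, ∃ u : E, ∀ p : ℤ × Fin N,
      inner ℂ (b p) u = scalarCoef a (fun x => f.1 x p.2) p.1 := by
    intro f
    have hs := summable_coef_section ha f.2.1
    refine exists_inner_eq b _ ?_
    refine Summable.of_nonneg_of_le (fun p => by positivity) (fun p => ?_)
      (hs.mul_left (∑' p : ℤ × Fin N, ‖scalarCoef a (fun x => f.1 x p.2) p.1‖))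
    rw [sq]
    exact mul_le_mul_of_nonneg_right (hs.le_tsum p fun _ _ => norm_nonneg _) (norm_nonneg _)
  choose U hU using hex
  have hcont : ∀ (f : eigenspace a V lam) i, Continuous fun x => f.1 x i := fun f i =>
    (continuous_apply i).comp f.2.1.1.continuous
  let L : eigenspace a V lam →ₗ[ℂ] pertEigenspace b (freeEigenvalue a) T lam :=
    { toFun := fun f => ⟨U f, mem_pertEigenspace_of_section ha hV hVp hT f.2 fun m i => hU f (m, i)⟩
      map_add' := fun f g => Subtype.ext (ext_inner b fun p => by
        simp only [Submodule.coe_add, inner_add_right, hU]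
        exact scalarCoef_add (hcont f p.2) (hcont g p.2) p.1)
      map_smul' := fun z f => Subtype.ext (ext_inner b fun p => by
        simp only [Submodule.coe_smul, inner_smul_right, hU, RingHom.id_apply]
        exact scalarCoef_const_mul z _ p.1) }
  refine ⟨LinearEquiv.ofBijective L ⟨?_, ?_⟩⟩
  · rw [injective_iff_map_eq_zero]
    intro f hf
    refine Subtype.ext (funext fun x => funext fun i => ?_)
    refine eq_zero_of_scalarCoef_eq_zero ha (hcont f i) (fun x => congrFun (f.2.1.2 x) i)
      (fun m => ?_) x
    rw [← hU f (m, i)]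
    have : U f = 0 := congrArg Subtype.val hf
    rw [this, inner_zero_right]
  · rintro ⟨u, hu⟩
    obtain ⟨f, hf, hfu⟩ := exists_section_of_mem ha hV hVp hT hu
    refine ⟨⟨f, hf⟩, Subtype.ext (ext_inner b fun p => ?_)⟩
    change inner ℂ (b p) (U ⟨f, hf⟩) = inner ℂ (b p) u
    rw [hU, hfu]

end Correspondence

end CircleHeat

namespace CircleHeat

/-! ### The heat trace of -∂² + εQ. -/

section HeatTrace

variable {N : ℕ} {a : ℝ} {Q : ℝ → Matrix (Fin N) (Fin N) ℂ}

theorem scalarCoef_conj (a : ℝ) (f : ℝ → ℂ) (k : ℤ) :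
    scalarCoef a (fun x => starRingEnd ℂ (f x)) (-k) = starRingEnd ℂ (scalarCoef a f k) := by
  rw [scalarCoef, scalarCoef, map_mul, ← intervalIntegral.intervalIntegral_conj]
  congr 1
  · rw [show (1 / (2 * Real.pi * a) : ℂ) = ((1 / (2 * Real.pi * a) : ℝ) : ℂ) by push_cast; rfl,
      Complex.conj_ofReal]
  · refine intervalIntegral.integral_congr fun x _ => ?_
    simp only [map_mul, ← Complex.exp_conj]
    congr 2
    simp

theorem fourierCoef_neg (hQ : ∀ x, (Q x).IsHermitian) (k : ℤ) :
    fourierCoef a Q (-k) = (fourierCoef a Q k)ᴴ := by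
  ext i j
  rw [Matrix.conjTranspose_apply, fourierCoef_apply, fourierCoef_apply]
  change _ = starRingEnd ℂ _
  rw [← scalarCoef_conj]
  congr 1
  funext x
  exact ((hQ x).apply i j).symm

theorem fourierCoef_smul (ε : ℝ) (k : ℤ) (i j : Fin N) :
    fourierCoef a (fun x => (ε : ℂ) • Q x) k i j = ε * fourierCoef a Q k i j :=
  scalarCoef_const_mul (ε : ℂ) (fun x => Q x i j) k

theorem coefNormSq_eq (a : ℝ) (Q : ℝ → Matrix (Fin N) (Fin N) ℂ) (k : ℤ) :
    coefNormSq a Q k = ((∑ i, ∑ j, ‖fourierCoef a Q k i j‖ ^ 2 : ℝ) : ℂ) := by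
  rw [coefNormSq, Matrix.trace]
  push_cast
  refine Finset.sum_congr rfl fun i _ => ?_
  rw [Matrix.diag_apply, Matrix.mul_apply]
  refine Finset.sum_congr rfl fun j _ => ?_
  rw [Matrix.conjTranspose_apply]
  exact Complex.mul_conj' _

theorem trace_fourierCoef_zero (hQ : ∀ x, (Q x).IsHermitian) :
    (fourierCoef a Q 0).trace = ((fourierCoef a Q 0).trace.re : ℂ) := by
  refine (Complex.conj_eq_iff_re.1 ?_).symm
  have h := fourierCoef_neg (a := a) hQ 0
  rw [neg_zero] at h
  conv_rhs => rw [h, Matrix.trace_conjTranspose]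
  rfl

theorem freeEigenvalue_nonneg (a : ℝ) (p : ℤ × Fin N) : 0 ≤ freeEigenvalue a p := by
  unfold freeEigenvalue
  positivity

theorem tendsto_freeEigenvalue (ha : 0 < a) :
    Tendsto (freeEigenvalue (N := N) a) cofinite atTop := by
  have h := (summable_one_div_freeEigenvalue (N := N) ha one_pos).tendsto_cofinite_zero
  have h2 : Tendsto (fun p : ℤ × Fin N => 1 / (1 + 1 * freeEigenvalue a p)) cofinite (𝓝[>] 0) :=
    tendsto_nhdsWithin_iff.2 ⟨h, Eventually.of_forall fun p => by
      have := freeEigenvalue_nonneg a p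
      rw [Set.mem_Ioi]
      positivity⟩
  have h3 := tendsto_atTop_add_const_right _ (-1) h2.inv_tendsto_nhdsGT_zero
  refine h3.congr fun p => ?_
  simp

theorem mul_freeEigenvalue (a t : ℝ) (p : ℤ × Fin N) :
    t * freeEigenvalue a p = t / a ^ 2 * (p.1 : ℝ) ^ 2 := by
  rw [freeEigenvalue]
  ring

theorem summable_exp_neg_freeEigenvalue (ha : 0 < a) {t : ℝ} (ht : 0 < t) :
    Summable fun p : ℤ × Fin N => Real.exp (-(t * freeEigenvalue a p)) := by
  refine summable_prod_fin (fun p => (Real.exp_pos _).le) fun i => ?_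
  simp only [mul_freeEigenvalue]
  exact summable_exp_neg_mul_int_sq (s := t / a ^ 2) (by positivity)

variable {E : Type*} [NormedAddCommGroup E] [InnerProductSpace ℂ E]
  {b : HilbertBasis (ℤ × Fin N) ℂ E} {T : E →L[ℂ] E}

theorem smul_symm (hTs : ∀ x y, inner ℂ (T x) y = inner ℂ x (T y)) (ε : ℝ) (x y : E) :
    inner ℂ (((ε : ℂ) • T) x) y = inner ℂ x (((ε : ℂ) • T) y) := by
  rw [smul_apply, smul_apply, inner_smul_left, inner_smul_right, hTs, Complex.conj_ofReal]

theorem nonempty_eigenspace_smul_equiv [CompleteSpace E] (ha : 0 < a) (hQ : ∀ i j, ContDiff ℝ ∞ (fun x => Q x i j))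
    (hQp : Function.Periodic Q (2 * Real.pi * a))
    (hT : ∀ u m i, HasSum (fun k => ∑ j, fourierCoef a Q k i j * inner ℂ (b (m - k, j)) u)
      (inner ℂ (b (m, i)) (T u))) (ε lam : ℝ) :
    Nonempty (eigenspace a (fun x => (ε : ℂ) • Q x) lam ≃ₗ[ℂ]
      pertEigenspace b (freeEigenvalue a) ((ε : ℂ) • T) lam) := by
  refine nonempty_eigenspace_equiv ha (fun i j => ?_) (fun x => by simp only [hQp x])
    (fun u m i => ?_) lam
  · change ContDiff ℝ ∞ fun x => (ε : ℂ) * Q x i j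
    exact contDiff_const.mul (hQ i j)
  · simp only [fourierCoef_smul, mul_assoc, ← Finset.mul_sum, smul_apply, inner_smul_right]
    exact (hT u m i).mul_left _

variable [CompleteSpace E]

/-- The heat trace as a sum over an orthonormal basis of eigenvectors. -/
theorem exists_eigenbasis_heatTrace (ha : 0 < a) (hQ : ∀ i j, ContDiff ℝ ∞ (fun x => Q x i j))
    (hQp : Function.Periodic Q (2 * Real.pi * a))
    (hT : ∀ u m i, HasSum (fun k => ∑ j, fourierCoef a Q k i j * inner ℂ (b (m - k, j)) u)
      (inner ℂ (b (m, i)) (T u)))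
    (hTs : ∀ x y, inner ℂ (T x) y = inner ℂ x (T y)) (ε : ℝ) {t : ℝ} (ht : 0 < t) :
    ∃ (κ : Type) (φ : HilbertBasis κ ℂ E) (lam : κ → ℝ),
      (∀ n, φ n ∈ pertEigenspace b (fun p => t * freeEigenvalue a p) (((t * ε : ℝ) : ℂ) • T)
        (lam n)) ∧
      HasSum (fun lam : ℝ =>
        (Module.finrank ℂ (eigenspace a (fun x => (ε : ℂ) • Q x) lam) : ℝ) * Real.exp (-t * lam))
        (∑' n, Real.exp (-lam n)) := by
  obtain ⟨φ, hφ⟩ := exists_eigenbasis (b := b) (freeEigenvalue_nonneg a)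
    (tendsto_freeEigenvalue ha) (smul_symm hTs ε)
  -- Multiplying the eigenvalue equation by t turns e^{-tλ} into e^{-λ'}, the form used by the trace
  -- expansion.
  have hφ' : ∀ n, φ n ∈ pertEigenspace b (fun p => t * freeEigenvalue a p)
      (((t * ε : ℝ) : ℂ) • T) (t * n.1) := by
    intro n p
    have h := mem_pertEigenspace.1 (hφ n) p
    rw [smul_apply, inner_smul_right] at h ⊢
    push_cast
    linear_combination (t : ℂ) * h
  refine ⟨_, φ, fun n => t * n.1, hφ', ?_⟩
  have hs := summable_exp_neg_eigenvalue (summable_exp_neg_freeEigenvalue ha ht) hφ'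
  -- Grouping the eigenvectors by eigenvalue yields the multiplicities.
  have h := hs.hasSum.sigma fun lam => hasSum_fintype _
  convert h using 1
  funext lam
  obtain ⟨e⟩ := nonempty_eigenspace_smul_equiv (b := b) ha hQ hQp hT ε lam
  rw [e.finrank_eq]
  simp

/-- The second-order part of the expansion, resummed over the Fourier coefficients. -/
theorem hasSum_second_order {c : ℤ → Fin N → Fin N → ℝ} (hc0 : ∀ k i j, 0 ≤ c k i j)
    (hc : ∀ i j, Summable fun k => c k i j) {s : ℝ} (hs : 0 < s) :
    HasSum (fun m : ℤ × Fin N => ∑' p : ℤ × Fin N, expRem (s * (p.1 : ℝ) ^ 2) (s * (m.1 : ℝ) ^ 2) *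
        c (p.1 - m.1) p.2 m.2)
      (∑' k, (∑ i, ∑ j, c k i j) *
        (1 / 2 * ∫ ξ in (0 : ℝ)..1, ∑' n : ℤ, betaDualTerm k s ξ n)) := by
  obtain ⟨G, hG⟩ : ∃ G : ℤ → ℤ → ℝ, ∀ m k, G m k =
      expRem (s * ((m : ℝ) + k) ^ 2) (s * (m : ℝ) ^ 2) := ⟨_, fun _ _ => rfl⟩
  have hG0 : ∀ m k, 0 ≤ G m k := fun m k => hG m k ▸ expRem_nonneg _ _
  -- This majorant in m alone, against the summability of `c` in k, justifies exchanging the sums.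
  have hGle : ∀ m k, G m k ≤ 1 / (1 + s * (m : ℝ) ^ 2) := by
    intro m k
    have h1 : (0 : ℝ) ≤ s * (m : ℝ) ^ 2 := by positivity
    have h2 : -0 ≤ s * ((m : ℝ) + k) ^ 2 := by
      rw [neg_zero]
      positivity
    have h := abs_expRem_le le_rfl h2 h1
    rw [Real.exp_zero] at h
    rw [hG]
    exact (le_abs_self _).trans h
  have hdom := summable_one_div_one_add_mul_int_sq hs
  have hsum : ∀ i j, Summable fun p : ℤ × ℤ => G p.1 p.2 * c p.2 i j := by
    intro i j
    refine Summable.of_nonneg_of_le (fun p => mul_nonneg (hG0 _ _) (hc0 _ _ _)) (fun p => ?_)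
      (hdom.mul_of_nonneg (hc i j) (fun m => by positivity) fun k => hc0 k i j)
    exact mul_le_mul_of_nonneg_right (hGle _ _) (hc0 _ _ _)
  have hinner : ∀ m : ℤ × Fin N, ∑' p : ℤ × Fin N,
      expRem (s * (p.1 : ℝ) ^ 2) (s * (m.1 : ℝ) ^ 2) * c (p.1 - m.1) p.2 m.2 =
      ∑' k, ∑ i, G m.1 k * c k i m.2 := by
    rintro ⟨m, j⟩
    have hterm : ∀ p : ℤ × Fin N, expRem (s * (p.1 : ℝ) ^ 2) (s * (m : ℝ) ^ 2) *
        c (p.1 - m) p.2 j = G m (p.1 - m) * c (p.1 - m) p.2 j := by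
      intro p
      simp only [hG]
      push_cast
      rw [add_sub_cancel]
    have hs0 : ∀ i, Summable fun k => G m (k - m) * c (k - m) i j := by
      intro i
      have h1 : Summable fun k => G m k * c k i j := (hsum i j).prod_factor m
      exact (Equiv.subRight m).summable_iff.2 h1
    have hs1 : Summable fun p : ℤ × Fin N => G m (p.1 - m) * c (p.1 - m) p.2 j :=
      summable_prod_fin (f := fun p : ℤ × Fin N => G m (p.1 - m) * c (p.1 - m) p.2 j)
        (fun p => mul_nonneg (hG0 _ _) (hc0 _ _ _)) hs0
    simp only [hterm]
    rw [hs1.tsum_prod' fun k => (hasSum_fintype _).summable]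
    simp only [tsum_fintype]
    exact (Equiv.subRight m).tsum_eq fun k => ∑ i, G m k * c k i j
  simp only [hinner]
  have hsumj : ∀ j, Summable fun p : ℤ × ℤ => ∑ i, G p.1 p.2 * c p.2 i j := fun j =>
    summable_sum fun i _ => hsum i j
  have hsumall : Summable fun p : ℤ × ℤ => ∑ j, ∑ i, G p.1 p.2 * c p.2 i j :=
    summable_sum fun j _ => hsumj j
  have hBj : ∀ j, Summable fun m => ∑' k, ∑ i, G m k * c k i j := fun j => (hsumj j).prod
  have hB : Summable fun m : ℤ × Fin N => ∑' k, ∑ i, G m.1 k * c k i m.2 :=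
    summable_prod_fin (fun m => tsum_nonneg fun k => Finset.sum_nonneg fun i _ =>
      mul_nonneg (hG0 _ _) (hc0 _ _ _)) hBj
  have hval : ∑' m : ℤ × Fin N, ∑' k, ∑ i, G m.1 k * c k i m.2 = ∑' k, (∑ i, ∑ j, c k i j) *
        (1 / 2 * ∫ ξ in (0 : ℝ)..1, ∑' n : ℤ, betaDualTerm k s ξ n) := by
    rw [hB.tsum_prod' fun k => (hasSum_fintype _).summable]
    simp only [tsum_fintype]
    have h1 : ∀ m, ∑ j, ∑' k, ∑ i, G m k * c k i j = ∑' k, ∑ j, ∑ i, G m k * c k i j := fun m =>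
      (Summable.tsum_finsetSum fun j _ => (hsumj j).prod_factor m).symm
    have h4 := Summable.tsum_comm (f := fun m k => ∑ j, ∑ i, G m k * c k i j) hsumall
    rw [tsum_congr h1, ← h4]
    refine tsum_congr fun k => ?_
    -- With the frequency difference k fixed, the coefficients do not depend on m, so only the sum
    -- of `expRem` over m remains.
    have h2 : ∀ m, ∑ j, ∑ i, G m k * c k i j = G m k * ∑ i, ∑ j, c k i j := fun m => by
      rw [Finset.sum_comm, Finset.mul_sum]
      simp only [Finset.mul_sum]
    have h3 : HasSum (fun m => G m k)
        (1 / 2 * ∫ ξ in (0 : ℝ)..1, ∑' n : ℤ, betaDualTerm k s ξ n) := by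
      simp only [hG]
      exact hasSum_expRem hs k
    simp only [h2]
    rw [tsum_mul_right, h3.tsum_eq, mul_comm]
  rw [← hval]
  exact hB.hasSum

theorem summable_fourierCoef_sq (hq : ∀ i j, Summable fun k => ‖fourierCoef a Q k i j‖)
    (i j : Fin N) : Summable fun k => ‖fourierCoef a Q k i j‖ ^ 2 := by
  refine Summable.of_nonneg_of_le (fun p => by positivity) (fun p => ?_)
    ((hq i j).mul_left (∑' k, ‖fourierCoef a Q k i j‖))
  rw [sq]
  exact mul_le_mul_of_nonneg_right ((hq i j).le_tsum p fun _ _ => norm_nonneg _) (norm_nonneg _)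

/-- The zeroth- and first-order parts of the expansion. -/
theorem hasSum_first_order {s : ℝ} (hs : 0 < s) (d : Fin N → ℝ) :
    HasSum (fun m : ℤ × Fin N => Real.exp (-(s * (m.1 : ℝ) ^ 2)) * (1 - d m.2))
      ((∑' n : ℤ, Real.exp (-(s * (n : ℝ) ^ 2))) * (N - ∑ i, d i)) := by
  have h0 := summable_exp_neg_mul_int_sq hs
  have hfs : Summable fun m : ℤ × Fin N => Real.exp (-(s * (m.1 : ℝ) ^ 2)) * (1 - d m.2) := by
    refine Summable.of_norm (summable_prod_fin (fun m => norm_nonneg _) fun i => ?_)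
    exact (h0.mul_right (1 - d i)).norm
  have hval : ∑' m : ℤ × Fin N, Real.exp (-(s * (m.1 : ℝ) ^ 2)) * (1 - d m.2) =
      (∑' n : ℤ, Real.exp (-(s * (n : ℝ) ^ 2))) * (N - ∑ i, d i) := by
    rw [hfs.tsum_prod' fun k => (hasSum_fintype _).summable, ← tsum_mul_right]
    refine tsum_congr fun n => ?_
    rw [tsum_fintype]
    simp only [← Finset.mul_sum, Finset.sum_sub_distrib]
    simp
  rw [← hval]
  exact hfs.hasSum

theorem abs_heatTrace_sub_le (ha : 0 < a) (hQ : ∀ i j, ContDiff ℝ ∞ (fun x => Q x i j))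
    (hQp : Function.Periodic Q (2 * Real.pi * a))
    (hT : ∀ u m i, HasSum (fun k => ∑ j, fourierCoef a Q k i j * inner ℂ (b (m - k, j)) u)
      (inner ℂ (b (m, i)) (T u)))
    (hTs : ∀ x y, inner ℂ (T x) y = inner ℂ x (T y))
    (hTn : ‖T‖ ≤ ∑' k, ∑ i, ∑ j, ‖fourierCoef a Q k i j‖) (ε : ℝ) {t : ℝ} (ht : 0 < t) :
    |heatTrace a (fun x => (ε : ℂ) • Q x) t -
      ((∑' n : ℤ, Real.exp (-(t / a ^ 2 * (n : ℝ) ^ 2))) *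
        (N - t * (ε * (fourierCoef a Q 0).trace.re)) +
        (t * ε) ^ 2 * ∑' k, (∑ i, ∑ j, ‖fourierCoef a Q k i j‖ ^ 2) *
        (1 / 2 * ∫ ξ in (0 : ℝ)..1, ∑' n : ℤ, betaDualTerm k (t / a ^ 2) ξ n))| ≤
      (|t * ε| * ∑' k, ∑ i, ∑ j, ‖fourierCoef a Q k i j‖) ^ 3 *
        (Real.exp (|t * ε| * ∑' k, ∑ i, ∑ j, ‖fourierCoef a Q k i j‖) *
          ∑' p : ℤ × Fin N, 1 / (1 + t * freeEigenvalue a p)) := by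
  have hq := summable_fourierCoef ha hQ hQp
  have hs : 0 < t / a ^ 2 := by positivity
  obtain ⟨κ, φ, lam, hφ, htr⟩ := exists_eigenbasis_heatTrace ha hQ hQp hT hTs ε ht
  have hentry : ∀ p m : ℤ × Fin N, inner ℂ (b p) ((((t * ε : ℝ) : ℂ) • T) (b m)) =
      ((t * ε : ℝ) : ℂ) * fourierCoef a Q (p.1 - m.1) p.2 m.2 := by
    intro p m
    rw [smul_apply, inner_smul_right, inner_convolution_basis hT]
  have hnorm : ∀ p m : ℤ × Fin N, ‖inner ℂ (b p) ((((t * ε : ℝ) : ℂ) • T) (b m))‖ =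
      |t * ε| * ‖fourierCoef a Q (p.1 - m.1) p.2 m.2‖ := by
    intro p m
    rw [hentry, norm_mul, Complex.norm_real, Real.norm_eq_abs]
  obtain ⟨-, hmain⟩ := abs_heat_trace_sub_le (smul_symm hTs (t * ε))
    (fun p => mul_nonneg ht.le (freeEigenvalue_nonneg a p))
    (summable_exp_neg_freeEigenvalue ha ht) (summable_one_div_freeEigenvalue ha ht) hφ
    (K := |t * ε| * ∑' k, ∑ i, ∑ j, ‖fourierCoef a Q k i j‖)
    (by
      rw [norm_smul, Complex.norm_real, Real.norm_eq_abs]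
      gcongr)
    (fun m => by
      simp only [hnorm]
      exact (summable_column hq m).mul_left _)
    (fun m => by
      simp only [hnorm]
      rw [tsum_mul_left]
      have := tsum_column_le hq m
      gcongr)
  have hfirst : ∀ m : ℤ × Fin N, (inner ℂ (b m) ((((t * ε : ℝ) : ℂ) • T) (b m))).re =
      t * ε * (fourierCoef a Q 0 m.2 m.2).re := by
    intro m
    rw [hentry, sub_self, Complex.re_ofReal_mul]
  simp only [hfirst, hnorm, mul_pow, sq_abs, mul_freeEigenvalue, mul_left_comm _ (t ^ 2 * ε ^ 2),
    tsum_mul_left] at hmain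
  have hsec := (hasSum_second_order (c := fun k i j => ‖fourierCoef a Q k i j‖ ^ 2)
    (fun k i j => by positivity) (summable_fourierCoef_sq hq) hs).mul_left (t ^ 2 * ε ^ 2)
  have hfs := hasSum_first_order hs fun i => t * ε * (fourierCoef a Q 0 i i).re
  have htrace : ∑ i, t * ε * (fourierCoef a Q 0 i i).re =
      t * (ε * (fourierCoef a Q 0).trace.re) := by
    rw [← Finset.mul_sum, Matrix.trace, Complex.re_sum, mul_assoc]
    rfl
  rw [htrace] at hfs
  rw [hfs.summable.tsum_add hsec.summable, hfs.tsum_eq, hsec.tsum_eq] at hmain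
  rw [heatTrace, htr.tsum_eq, mul_pow t ε]
  simpa only [mul_freeEigenvalue, mul_pow, sq_abs] using hmain

end HeatTrace

end CircleHeat

namespace CircleHeat

/-! ### Normalising constants and assembly. -/

section MainTheorem

variable {N : ℕ} {a : ℝ} {Q : ℝ → Matrix (Fin N) (Fin N) ℂ}

/-- The normalisation of Ω is 2πa times the Poisson factor √s/√π with s = t/a², the one relating
both θ and β_k to their dual forms. -/
theorem sqrt_four_pi_mul (ha : 0 < a) {t : ℝ} (ht : 0 < t) :
    Real.sqrt (4 * Real.pi * t) =
      2 * Real.pi * a * (Real.sqrt (t / a ^ 2) / Real.sqrt Real.pi) := by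
  have hπ := Real.sqrt_pos.2 Real.pi_pos
  have h4 : Real.sqrt 4 = 2 := by
    rw [show (4 : ℝ) = 2 ^ 2 by norm_num, Real.sqrt_sq zero_le_two]
  rw [Real.sqrt_mul (by positivity), Real.sqrt_mul (by norm_num), h4, Real.sqrt_div ht.le,
    Real.sqrt_sq ha.le]
  field_simp
  rw [Real.sq_sqrt Real.pi_pos.le]

theorem summable_coefNormSq_mul_beta
    (hq : ∀ i j, Summable fun k => ‖fourierCoef a Q k i j‖) {s : ℝ} (hs : 0 < s) :
    Summable fun k : ℤ => coefNormSq a Q k * beta k s := by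
  have h1 : Summable fun k => ∑ i, ∑ j, ‖fourierCoef a Q k i j‖ ^ 2 :=
    summable_sum fun i _ => summable_sum fun j _ => summable_fourierCoef_sq hq i j
  refine Summable.of_norm_bounded (h1.mul_right (theta s)) fun k => ?_
  have h0 : 0 ≤ ∑ i, ∑ j, ‖fourierCoef a Q k i j‖ ^ 2 := by positivity
  rw [norm_mul, coefNormSq_eq, Complex.norm_real, Real.norm_of_nonneg h0]
  exact mul_le_mul_of_nonneg_left (norm_beta_le hs k) h0

/-- The expansion in the statement, as a multiple of the expansion of the heat trace. -/
theorem expansion_eq (ha : 0 < a) (hQh : ∀ x, (Q x).IsHermitian) {t : ℝ} (ht : 0 < t) (ε : ℝ) :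
    (theta (t / a ^ 2) : ℂ) * (2 * Real.pi * a) * (N - t * (ε * (fourierCoef a Q 0).trace)) +
      Real.pi * a * t ^ 2 * ∑' k : ℤ, (ε : ℂ) ^ 2 * coefNormSq a Q k * beta k (t / a ^ 2) =
    ((Real.sqrt (4 * Real.pi * t) * ((∑' n : ℤ, Real.exp (-(t / a ^ 2 * (n : ℝ) ^ 2))) *
        (N - t * (ε * (fourierCoef a Q 0).trace.re)) +
        (t * ε) ^ 2 * ∑' k, (∑ i, ∑ j, ‖fourierCoef a Q k i j‖ ^ 2) *
        (1 / 2 * ∫ ξ in (0 : ℝ)..1, ∑' n : ℤ, betaDualTerm k (t / a ^ 2) ξ n)) : ℝ) : ℂ) := by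
  have hs : 0 < t / a ^ 2 := by positivity
  set r := Real.sqrt (t / a ^ 2) / Real.sqrt Real.pi with hr
  have hsum : ∑' k : ℤ, (ε : ℂ) ^ 2 * coefNormSq a Q k * beta k (t / a ^ 2) =
      ((2 * r * ε ^ 2 * ∑' k, (∑ i, ∑ j, ‖fourierCoef a Q k i j‖ ^ 2) *
        (1 / 2 * ∫ ξ in (0 : ℝ)..1, ∑' n : ℤ, betaDualTerm k (t / a ^ 2) ξ n) : ℝ) : ℂ) := by
    rw [← tsum_mul_left, Complex.ofReal_tsum]
    refine tsum_congr fun k => ?_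
    rw [coefNormSq_eq, beta_eq hs, ← Complex.ofReal_pow, ← Complex.ofReal_mul,
      ← Complex.ofReal_mul]
    congr 1
    ring
  rw [hsum, trace_fourierCoef_zero hQh, theta_eq hs, sqrt_four_pi_mul ha ht, ← hr, Complex.ofReal_re]
  set S₁ := ∑' n : ℤ, Real.exp (-(t / a ^ 2 * (n : ℝ) ^ 2))
  set S₂ := ∑' k, (∑ i, ∑ j, ‖fourierCoef a Q k i j‖ ^ 2) *
    (1 / 2 * ∫ ξ in (0 : ℝ)..1, ∑' n : ℤ, betaDualTerm k (t / a ^ 2) ξ n)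
  push_cast
  ring

theorem exists_fourier_operator (ha : 0 < a) (hQ : ∀ i j, ContDiff ℝ ∞ (fun x => Q x i j))
    (hQp : Function.Periodic Q (2 * Real.pi * a)) (hQh : ∀ x, (Q x).IsHermitian)
    {E : Type*} [NormedAddCommGroup E] [InnerProductSpace ℂ E] [CompleteSpace E]
    (b : HilbertBasis (ℤ × Fin N) ℂ E) :
    ∃ T : E →L[ℂ] E,
      (∀ u m i, HasSum (fun k => ∑ j, fourierCoef a Q k i j * inner ℂ (b (m - k, j)) u)
        (inner ℂ (b (m, i)) (T u))) ∧
      (∀ x y, inner ℂ (T x) y = inner ℂ x (T y)) ∧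
      ‖T‖ ≤ ∑' k, ∑ i, ∑ j, ‖fourierCoef a Q k i j‖ := by
  obtain ⟨T, hT, hTn⟩ := exists_convolution b (fourierCoef a Q) (summable_fourierCoef ha hQ hQp)
  exact ⟨T, hT, convolution_symm hT (fourierCoef_neg hQh), hTn⟩

/-- The Hilbert basis of `ℓ²` indexed by Fourier modes and components. -/
noncomputable def modeBasis (N : ℕ) :
    HilbertBasis (ℤ × Fin N) ℂ (lp (fun _ : ℤ × Fin N => ℂ) 2) :=
  HilbertBasis.ofRepr (LinearIsometryEquiv.refl ℂ _)

theorem heat_expansion (ha : 0 < a) (hQ : ∀ i j, ContDiff ℝ ∞ (fun x => Q x i j))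
    (hQp : Function.Periodic Q (2 * Real.pi * a)) (hQh : ∀ x, (Q x).IsHermitian) {t : ℝ}
    (ht : 0 < t) :
    (fun ε : ℝ => (Omega a (fun x => (ε : ℂ) • Q x) t : ℂ) -
      ((theta (t / a ^ 2) : ℂ) * (2 * Real.pi * a) * (N - t * (ε * (fourierCoef a Q 0).trace)) +
        Real.pi * a * t ^ 2 *
          ∑' k : ℤ, (ε : ℂ) ^ 2 * coefNormSq a Q k * beta k (t / a ^ 2)))
      =O[𝓝 0] fun ε : ℝ => ε ^ 3 := by
  obtain ⟨T, hT, hTs, hTn⟩ := exists_fourier_operator ha hQ hQp hQh (modeBasis N)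
  set K := ∑' k, ∑ i, ∑ j, ‖fourierCoef a Q k i j‖ with hK
  have hK0 : 0 ≤ K := (norm_nonneg T).trans hTn
  set S := ∑' p : ℤ × Fin N, 1 / (1 + t * freeEigenvalue a p) with hS
  have hS0 : 0 ≤ S := tsum_nonneg fun p => by
    have := freeEigenvalue_nonneg a p
    positivity
  refine IsBigO.of_bound (Real.sqrt (4 * Real.pi * t) * ((t * K) ^ 3 * (Real.exp (t * K) * S))) ?_
  -- On |ε| ≤ 1 the exponential factor of the error is bounded by a constant, leaving |ε|³.
  filter_upwards [Metric.closedBall_mem_nhds (0 : ℝ) one_pos] with ε hε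
  have hε1 : |ε| ≤ 1 := by simpa using hε
  have h := abs_heatTrace_sub_le ha hQ hQp hT hTs hTn ε ht
  rw [← hK, ← hS] at h
  rw [expansion_eq ha hQh ht, Omega, ← Complex.ofReal_sub, Complex.norm_real, ← mul_sub, norm_mul,
    Real.norm_of_nonneg (Real.sqrt_nonneg _), Real.norm_eq_abs, mul_assoc (Real.sqrt _)]
  refine mul_le_mul_of_nonneg_left (h.trans ?_) (Real.sqrt_nonneg _)
  rw [abs_mul, abs_of_pos ht, norm_pow, Real.norm_eq_abs]
  calc (t * |ε| * K) ^ 3 * (Real.exp (t * |ε| * K) * S)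
      ≤ (t * |ε| * K) ^ 3 * (Real.exp (t * 1 * K) * S) := by gcongr
    _ = (t * K) ^ 3 * (Real.exp (t * K) * S) * |ε| ^ 3 := by
      rw [mul_one]
      ring

end MainTheorem

end CircleHeat

theorem mainTheorem5 :
    -- second-order expansion of the heat trace function of `-D² + εQ`
    (∀ (N : ℕ) (a : ℝ) (_ : 0 < a) (Q : ℝ → Matrix (Fin N) (Fin N) ℂ)
      (_ : ∀ i j, ContDiff ℝ ∞ (fun x => Q x i j))
      (_ : Function.Periodic Q (2 * Real.pi * a))
      (_ : ∀ x, (Q x).IsHermitian),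
      (∀ ε lam : ℝ, FiniteDimensional ℂ
        (CircleHeat.eigenspace a (fun x => (ε : ℂ) • Q x) lam)) ∧
      ∀ t : ℝ, 0 < t →
        (∀ ε : ℝ, Summable fun lam : ℝ =>
          (Module.finrank ℂ (CircleHeat.eigenspace a (fun x => (ε : ℂ) • Q x) lam) : ℝ)
            * Real.exp (-t * lam)) ∧
        (Summable fun k : ℤ =>
          CircleHeat.coefNormSq a Q k * CircleHeat.beta k (t / a ^ 2)) ∧
        (fun ε : ℝ =>
          (CircleHeat.Omega a (fun x => (ε : ℂ) • Q x) t : ℂ)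
            - ((CircleHeat.theta (t / a ^ 2) : ℂ) * (2 * Real.pi * a)
                  * (N - t * (ε * (CircleHeat.fourierCoef a Q 0).trace))
                + Real.pi * a * t ^ 2
                  * ∑' k : ℤ, (ε : ℂ) ^ 2 * CircleHeat.coefNormSq a Q k
                      * CircleHeat.beta k (t / a ^ 2)))
          =O[𝓝 0] fun ε : ℝ => ε ^ 3) ∧
    -- convergence and the two (Poisson dual) forms of `θ`
    (∀ s : ℝ, 0 < s →
      (Summable fun n : ℤ => Real.exp (-(1 / s * Real.pi ^ 2 * (n : ℝ) ^ 2))) ∧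
      (Summable fun n : ℤ => Real.exp (-(s * (n : ℝ) ^ 2))) ∧
      CircleHeat.theta s
        = Real.sqrt s / Real.sqrt Real.pi * ∑' n : ℤ, Real.exp (-(s * (n : ℝ) ^ 2))) ∧
    -- convergence and the two (Poisson dual) forms of `βₖ`
    (∀ (k : ℤ) (s : ℝ), 0 < s →
      (∀ ξ ∈ Set.Icc (0 : ℝ) 1, Summable (CircleHeat.betaTerm k s ξ)) ∧
      (∀ ξ ∈ Set.Icc (0 : ℝ) 1, Summable (CircleHeat.betaDualTerm k s ξ)) ∧
      IntervalIntegrable (fun ξ : ℝ => ∑' n : ℤ, CircleHeat.betaTerm k s ξ n)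
        MeasureTheory.volume 0 1 ∧
      IntervalIntegrable (fun ξ : ℝ => ∑' n : ℤ, CircleHeat.betaDualTerm k s ξ n)
        MeasureTheory.volume 0 1 ∧
      CircleHeat.beta k s
        = ((Real.sqrt s / Real.sqrt Real.pi
            * ∫ ξ in (0 : ℝ)..1, ∑' n : ℤ, CircleHeat.betaDualTerm k s ξ n : ℝ) : ℂ)) ∧
    -- the limit of infinite radius, for each `k` and uniformly in `k`
    (∀ t : ℝ, 0 < t →
      (∀ k : ℤ, (fun a : ℝ => CircleHeat.beta k (t / a ^ 2))
        ~[atTop] fun a : ℝ => (CircleHeat.alpha (t / a ^ 2 * (k : ℝ) ^ 2) : ℂ)) ∧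
      TendstoUniformly
        (fun (a : ℝ) (k : ℤ) =>
          CircleHeat.beta k (t / a ^ 2) / (CircleHeat.alpha (t / a ^ 2 * (k : ℝ) ^ 2) : ℂ))
        (fun _ => 1) atTop) := by
  refine ⟨?_, ?_, ?_, ?_⟩
  · intro N a ha Q hQ hQp hQh
    obtain ⟨T, hT, hTs, -⟩ :=
      CircleHeat.exists_fourier_operator ha hQ hQp hQh (CircleHeat.modeBasis N)
    refine ⟨fun ε lam => ?_, fun t ht => ⟨fun ε => ?_, ?_, ?_⟩⟩
    · obtain ⟨e⟩ := CircleHeat.nonempty_eigenspace_smul_equiv ha hQ hQp hT ε lam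
      have := CircleHeat.finiteDimensional_pertEigenspace (b := CircleHeat.modeBasis N)
        (CircleHeat.freeEigenvalue_nonneg a) (CircleHeat.tendsto_freeEigenvalue ha)
        (CircleHeat.smul_symm hTs ε) lam
      exact e.symm.finiteDimensional
    · obtain ⟨_, _, _, _, h⟩ := CircleHeat.exists_eigenbasis_heatTrace ha hQ hQp hT hTs ε ht
      exact h.summable
    · exact CircleHeat.summable_coefNormSq_mul_beta
        (CircleHeat.summable_fourierCoef ha hQ hQp) (by positivity)
    · exact CircleHeat.heat_expansion ha hQ hQp hQh ht
  · exact fun s hs => ⟨CircleHeat.summable_theta hs, CircleHeat.summable_exp_neg_mul_int_sq hs,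
      CircleHeat.theta_eq hs⟩
  · exact fun k s hs => ⟨fun ξ hξ => CircleHeat.summable_betaTerm hs hξ k,
      fun ξ hξ => CircleHeat.summable_betaDualTerm hs hξ k,
      CircleHeat.intervalIntegrable_tsum_betaTerm hs k,
      CircleHeat.intervalIntegrable_tsum_betaDualTerm hs k, CircleHeat.beta_eq hs k⟩
  · intro t ht
    refine ⟨fun k => ?_, CircleHeat.tendstoUniformly_beta_div_alpha ht⟩
    exact isEquivalent_of_tendsto_one
      ((CircleHeat.tendstoUniformly_beta_div_alpha ht).tendsto_at k)
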